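/- Let $\nu\neq 0$ be a finite Borel measure on $(0,1)$ and let $\Lambda$ denote Lebesgue measure. **Spectral dimensions.** Let $H^1_0$ be the space of $f:[0,1]\to\mathbb R$ with $f(0)=f(1)=0$ for which there is $\nabla f\in L^2([0,1],\Lambda)$ with $f(x)=f(0)+\int_0^x\nabla f\,d\Lambda$ for all $x\in[0,1]$, and let $\operatorname{dom}\mathcal E_\nu$ be the space of those $f\in H^1_0$ that are affine on every connected component of $[0,1]\setminus\operatorname{supp}\nu$. A nonzero $f\in\operatorname{dom}\mathcal E_\nu$ is an eigenfunction with eigenvalue $\lambda$ if $\int_0^1\nabla f\,\nabla g\,d\Lambda=\lambda\int fg\,d\nu$ for all $g\in\operatorname{dom}\mathcal E_\nu$. Let $N_\nu(x)$ be the number of eigenvalues not exceeding $x$, counted with multiplicity, and $$\underline s_\nu=\liminf_{x\to\infty}\frac{\log N_\nu(x)}{\log x},\qquad \overline s_\nu=\limsup_{x\to\infty}\frac{\log N_\nu(x)}{\log x}.$$ If the two coincide, the common value $s_\nu$ is called the spectral dimension. **Partition entropies.** Let $\mathcal N^R(x)$ be the least $n$ for which there are $0=c_0<c_1<\dots<c_n=1$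 with $\nu(\{c_k\})=0$ for all $k$ and $\nu(C)\Lambda(C)<1/x$ for every $C=(c_{k-1},c_k]$, $1\le k\le n$. For $m>1$ let $\mathcal N^L_m(x)$ be the supremum of the cardinalities of finite families of pairwise disjoint intervals $C=(a,b]$, $0\le a<b\le1$, $\nu(\{a\})=\nu(\{b\})=0$, with $\nu(\langle C\rangle_m)\Lambda(\langle C\rangle_m)\ge\frac{4}{x(m-1)}$ for every member $C$, where $\langle C\rangle_m$ is the closed interval of length $\Lambda(C)/m$ with the same centre as $C$. Let $\underline h_\nu,\overline h_\nu$ and $\underline h^m_\nu,\overline h^m_\nu$ be the lower and upper limits, as $x\to\infty$, of $\log\mathcal N^R(x)/\log x$ and of $\log\mathcal N^L_m(x)/\log x$. **$L^q$-spectrum and coarse multifractal dimensions.** Let $\mathcal D_n$ be the set of the intervals $(k2^{-n},(k+1)2^{-n}]$, $0\le k<2^n$, and $$\beta_n(q)=\frac1{\log 2^n}\log\sum_{C\in\mathcal D_n,\ \nu(C)>0}\nu(C)^q,\qquad q\in\mathbb R.$$ For every $n\ge1$ with $2^n>\nu((0,1))$, the function $\beta_n$ has a unique fixed point $q_n$;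 put $\overline q_\nu=\limsup_n q_n$. With $\mathcal N_\alpha(n)=\#\{C\in\mathcal D_n:\nu(C)\ge2^{-\alpha n}\}$ and $\log^+t=\max(0,\log t)$, $\log^+0=0$, put $$\underline F_\nu=\sup_{\alpha>0}\frac1{1+\alpha}\liminf_{n\to\infty}\frac{\log^+\mathcal N_\alpha(n)}{\log2^n},\qquad \overline F_\nu=\sup_{\alpha>0}\frac1{1+\alpha}\limsup_{n\to\infty}\frac{\log^+\mathcal N_\alpha(n)}{\log2^n}.$$ Call $\nu$ *regular* if $\sup_{m>1}\underline h^m_\nu=\overline h_\nu$, and *MF-regular* if $\underline F_\nu=\overline F_\nu$. **Theorem.** 1. For all $1<m\le3$, $$\underline F_\nu\le\underline h^m_\nu\le\underline s_\nu\le\underline h_\nu\le\overline h_\nu=\overline h^m_\nu=\overline s_\nu=\overline q_\nu=\overline F_\nu .$$ 2. $\overline q_\nu\le\frac12$. 3. If $\underline s_\nu=\overline s_\nu$, then $\underline h_\nu=\overline h_\nu=s_\nu$. 4. If $\nu$ is regular, then $\underline s_\nu=\overline s_\nu=\overline h_\nu$. 5. If $\nu$ is MF-regular, then equality holds everywhere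 in the chain of part 1 for all $1<m\le3$, and $\nu$ is regular. 6. If $\underline h^m_\nu\ge\frac12$ for some $m>1$, then $\underline s_\nu=\overline s_\nu=\frac12=\overline h_\nu$. -/

import Mathlib

open MeasureTheory Filter Set
open scoped ENNReal unitInterval

noncomputable section

namespace KreinFeller

/-! Throughout, `ν` is a Borel measure on `ℝ`; the theorem assumes that it is finite, nonzero and
carried by `(0,1)`. The unit interval `[0,1]` is Mathlib's `unitInterval`, written `I`. -/

/-! ### The Dirichlet form and its eigenvalues -/

/-- `g ∈ L²([0,1])` is a weak derivative of `f`: `f x = f 0 + ∫₀ˣ g` for all `x ∈ [0,1]`. -/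
def HasWeakDeriv (f : C(I, ℝ)) (g : ℝ → ℝ) : Prop :=
  MemLp g 2 (volume.restrict (Icc (0 : ℝ) 1)) ∧
    ∀ x : I, f x = f 0 + ∫ t in (0 : ℝ)..(x : ℝ), g t

/-- The Sobolev space `H¹(0,1)`. -/
def MemH1 (f : C(I, ℝ)) : Prop := ∃ g : ℝ → ℝ, HasWeakDeriv f g

/-- The subspace `H¹₀(0,1)` of functions that vanish at both end points. -/
def MemH10 (f : C(I, ℝ)) : Prop := MemH1 f ∧ f 0 = 0 ∧ f 1 = 0

/-- The weak derivative of `f ∈ H¹(0,1)`. It is unique up to Lebesgue null sets, and every use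
below is under an integral. -/
def weakDeriv (f : C(I, ℝ)) : ℝ → ℝ := Classical.epsilon (HasWeakDeriv f)

/-- `f` is affine on each connected component of `[0,1] \ supp ν`. -/
def AffineOffSupport (ν : Measure ℝ) (f : C(I, ℝ)) : Prop :=
  ∀ x : I, (x : ℝ) ∉ ν.support →
    ∃ a b : ℝ, ∀ y ∈ connectedComponentIn {z : I | (z : ℝ) ∉ ν.support} x, f y = a * y + b

/-- The domain of the Dirichlet form. -/
def MemDom (ν : Measure ℝ) (f : C(I, ℝ)) : Prop := MemH10 f ∧ AffineOffSupport ν f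

/-- The energy `∫₀¹ f' g'`. -/
def energy (f g : C(I, ℝ)) : ℝ := ∫ t in Icc (0 : ℝ) 1, weakDeriv f t * weakDeriv g t

/-- The inner product of `L²(ν)`, where `ν` is viewed as a measure on `[0,1]`. -/
def innerL2 (ν : Measure ℝ) (f g : C(I, ℝ)) : ℝ :=
  ∫ x, f x * g x ∂(ν.comap (Subtype.val : I → ℝ))

/-- `f` is an eigenfunction of the Dirichlet form with eigenvalue `l`. -/
def IsEigenfunction (ν : Measure ℝ) (l : ℝ) (f : C(I, ℝ)) : Prop :=
  MemDom ν f ∧ f ≠ 0 ∧ ∀ g : C(I, ℝ), MemDom ν g → energy f g = l * innerL2 ν f g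

/-- The eigenvalue counting function: the number of eigenvalues not exceeding `x`, counted with
multiplicity, that is, the dimension of the space spanned by the eigenfunctions whose
eigenvalue is at most `x`. -/
def eigenvalueCount (ν : Measure ℝ) (x : ℝ) : ℕ∞ :=
  Cardinal.toENat (Module.rank ℝ
    (Submodule.span ℝ {f : C(I, ℝ) | ∃ l : ℝ, l ≤ x ∧ IsEigenfunction ν l f}))

/-! ### Exponents of growth -/

/-- `log N(x) / log x`, with `log 0 = -∞` and `log ∞ = ∞`. -/
def logRatio (N : ℝ → ℕ∞) (x : ℝ) : EReal :=
  ENNReal.log (N x : ℝ≥0∞) / ((Real.log x : ℝ) : EReal)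

/-- `limsup_{x → ∞} log N(x) / log x`. -/
def upperExponent (N : ℝ → ℕ∞) : EReal := limsup (logRatio N) atTop

/-- `liminf_{x → ∞} log N(x) / log x`. -/
def lowerExponent (N : ℝ → ℕ∞) : EReal := liminf (logRatio N) atTop

/-- The upper spectral dimension. -/
def upperSpectralDim (ν : Measure ℝ) : EReal := upperExponent (eigenvalueCount ν)

/-- The lower spectral dimension. -/
def lowerSpectralDim (ν : Measure ℝ) : EReal := lowerExponent (eigenvalueCount ν)

/-! ### Partition entropy -/

/-- `0 = c 0 < c 1 < ⋯ < c n = 1` are the cut points of a `ν`-partition of `(0,1]` into the `n`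
half-open intervals `(c k, c (k+1)]`: none of them is an atom of `ν`. -/
def IsPartition (ν : Measure ℝ) {n : ℕ} (c : Fin (n + 1) → ℝ) : Prop :=
  StrictMono c ∧ c 0 = 0 ∧ c (Fin.last n) = 1 ∧ ∀ k, ν {c k} = 0

/-- The least number of intervals in a `ν`-partition all of whose intervals `C` satisfy
`ν(C) Λ(C) < 1/x`. -/
def partitionCount (ν : Measure ℝ) (x : ℝ) : ℕ∞ :=
  sInf {N : ℕ∞ | ∃ (n : ℕ) (c : Fin (n + 1) → ℝ), N = n ∧ IsPartition ν c ∧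
    ∀ k : Fin n, ν.real (Ioc (c k.castSucc) (c k.succ)) *
      volume.real (Ioc (c k.castSucc) (c k.succ)) < 1 / x}

/-- The upper `ν`-partition entropy. -/
def upperEntropy (ν : Measure ℝ) : EReal := upperExponent (partitionCount ν)

/-- The lower `ν`-partition entropy. -/
def lowerEntropy (ν : Measure ℝ) : EReal := lowerExponent (partitionCount ν)

/-- The closed interval of length `(b - a) / m` with the same centre as the interval with end
points `a` and `b`. -/
def centered (m a b : ℝ) : Set ℝ :=
  Icc ((a + b) / 2 - (b - a) / (2 * m)) ((a + b) / 2 + (b - a) / (2 * m))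

/-- `P` is a finite disjoint collection of subintervals `(a,b]` of `[0,1]`, each given by its
end points, with no atom of `ν` at an end point. -/
def IsIntervalFamily (ν : Measure ℝ) (P : Finset (ℝ × ℝ)) : Prop :=
  (∀ p ∈ P, 0 ≤ p.1 ∧ p.1 < p.2 ∧ p.2 ≤ 1 ∧ ν {p.1} = 0 ∧ ν {p.2} = 0) ∧
    (P : Set (ℝ × ℝ)).PairwiseDisjoint fun p => Ioc p.1 p.2

/-- The largest number of intervals in such a collection for which
`ν(⟨C⟩ₘ) Λ(⟨C⟩ₘ) ≥ 4 / (x (m - 1))` for every member `C`. -/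
def reducedCount (ν : Measure ℝ) (m x : ℝ) : ℕ∞ :=
  sSup {N : ℕ∞ | ∃ P : Finset (ℝ × ℝ), N = P.card ∧ IsIntervalFamily ν P ∧
    ∀ p ∈ P, 4 / (x * (m - 1)) ≤
      ν.real (centered m p.1 p.2) * volume.real (centered m p.1 p.2)}

/-- The upper `m`-reduced `ν`-partition entropy. -/
def upperReducedEntropy (ν : Measure ℝ) (m : ℝ) : EReal := upperExponent (reducedCount ν m)

/-- The lower `m`-reduced `ν`-partition entropy. -/
def lowerReducedEntropy (ν : Measure ℝ) (m : ℝ) : EReal := lowerExponent (reducedCount ν m)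

/-! ### The `L^q`-spectrum and the coarse multifractal dimensions -/

/-- The dyadic interval `(k 2⁻ⁿ, (k+1) 2⁻ⁿ]`. -/
def dyadic (n k : ℕ) : Set ℝ := Ioc ((k : ℝ) / 2 ^ n) (((k : ℝ) + 1) / 2 ^ n)

open Classical in
/-- `βₙ(q) = (log 2ⁿ)⁻¹ log ∑ ν(C)^q`, the sum over the dyadic intervals of level `n` in `(0,1]`
with positive measure. -/
def lqBeta (ν : Measure ℝ) (n : ℕ) (q : ℝ) : ℝ :=
  1 / Real.log (2 ^ n) *
    Real.log (∑ k ∈ (Finset.range (2 ^ n)).filter (fun k => 0 < ν (dyadic n k)),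
      ν.real (dyadic n k) ^ q)

/-- The fixed point of `βₙ`. -/
def lqFixedPoint (ν : Measure ℝ) (n : ℕ) : ℝ := Classical.epsilon fun q : ℝ => lqBeta ν n q = q

/-- `limsup qₙ`, where `qₙ` is the fixed point of `βₙ`. -/
def upperFixedPoint (ν : Measure ℝ) : EReal :=
  limsup (fun n : ℕ => ((lqFixedPoint ν n : ℝ) : EReal)) atTop

open Classical in
/-- The number of dyadic intervals of level `n` in `(0,1]` of measure at least `2^(-α n)`. -/
def coarseCount (ν : Measure ℝ) (α : ℝ) (n : ℕ) : ℕ :=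
  ((Finset.range (2 ^ n)).filter
    (fun k => (2 : ℝ) ^ (-(α * n)) ≤ ν.real (dyadic n k))).card

/-- `log⁺ N_α(n) / log 2ⁿ`. -/
def coarseRatio (ν : Measure ℝ) (α : ℝ) (n : ℕ) : ℝ :=
  Real.posLog (coarseCount ν α n) / Real.log (2 ^ n)

/-- The upper optimized coarse multifractal dimension. -/
def upperCoarseDim (ν : Measure ℝ) : EReal :=
  ⨆ (α : ℝ) (_ : 0 < α),
    limsup (fun n : ℕ => ((coarseRatio ν α n : ℝ) : EReal)) atTop / ((1 + α : ℝ) : EReal)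

/-- The lower optimized coarse multifractal dimension. -/
def lowerCoarseDim (ν : Measure ℝ) : EReal :=
  ⨆ (α : ℝ) (_ : 0 < α),
    liminf (fun n : ℕ => ((coarseRatio ν α n : ℝ) : EReal)) atTop / ((1 + α : ℝ) : EReal)

/-! ### Regularity -/

/-- `ν` is regular. -/
def IsRegular (ν : Measure ℝ) : Prop :=
  (⨆ (m : ℝ) (_ : 1 < m), lowerReducedEntropy ν m) = upperEntropy ν

/-- `ν` is MF-regular. -/
def IsMFRegular (ν : Measure ℝ) : Prop := lowerCoarseDim ν = upperCoarseDim ν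

end KreinFeller

end

noncomputable section

namespace KreinFeller

/-! ### Comparison of exponents -/

/-! Everything rests on the two-sided estimate `reducedCount` ≤ `eigenvalueCount` ≤
`partitionCount`, valid for every `x > 0`, and on a purely measure-theoretic comparison that brings
the upper exponent of the right side back below that of the left side.

Spectral part. A function `f` in `H¹₀` is replaced by its derivative `u` in `L²`, so that the form
becomes the inner product of a closed subspace and the mass term becomes `‖b u‖²` for a compact map
`b` into `L²(ν)`. On the span of the eigenvectors with eigenvalue at most `x` one has `‖u‖² ≤ x ‖b
u‖²`, whereas a nonzero function vanishing at the left end of every cell of an admissible partition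
satisfies the strict reverse inequality by Cauchy–Schwarz on each cell. Evaluation at the `n` left
ends is therefore injective on that span (`eigenvalueCount_le_partitionCount`). Conversely,
trapezoids on the members of an admissible disjoint family have Rayleigh quotient at most `x`.
Projecting away the functions that vanish on the support puts them into the domain without raising
the quotient, and the variational principle applies (`reducedCount_le_eigenvalueCount`).

Measure part. Let `Zₙ(q)` be the sum of `(ν(C) Λ(C))^q` over the charged dyadic cells of level `n`;
the fixed point `qₙ` is the root of `Zₙ = 1`. For `q` above the upper limit of the `qₙ`, Markov's
inequality leaves at most `x^q` cells with `ν(C) Λ(C) ≥ 1/x` on each large level, and only about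
`log x` levels matter; cutting all such cells at their midpoints gives a small partition
(`upperEntropy_le_upperFixedPoint`). Sorting cells by the size of their mass identifies the upper
limit of the `qₙ` with the upper coarse dimension. Finally, cells of mass at least `2^(-α n)`,
enlarged about their centres and thinned to one residue class modulo 4, form an admissible disjoint
family; this needs `m ≤ 3` and compares the coarse dimensions with the reduced entropies.

For upper exponents these inequalities form a cycle, hence all are equalities; for lower exponents
only part of the cycle survives. The bound `1/2` is Cauchy–Schwarz applied to `Zₙ(1/2)`, and the
remaining claims are formal consequences. -/

theorem logRatio_mono {N M : ℝ → ℕ∞} {x : ℝ} (hx : 1 ≤ x) (h : N x ≤ M x) :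
    logRatio N x ≤ logRatio M x := by
  unfold logRatio
  apply EReal.div_le_div_right_of_nonneg
  · exact_mod_cast Real.log_nonneg hx
  · apply ENNReal.log_monotone
    exact_mod_cast h

theorem upperExponent_mono {N M : ℝ → ℕ∞} (h : ∀ᶠ x in atTop, N x ≤ M x) :
    upperExponent N ≤ upperExponent M := by
  refine limsup_le_limsup ?_
  filter_upwards [h, eventually_ge_atTop 1] with x hx h1 using logRatio_mono h1 hx

theorem lowerExponent_mono {N M : ℝ → ℕ∞} (h : ∀ᶠ x in atTop, N x ≤ M x) :
    lowerExponent N ≤ lowerExponent M := by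
  refine liminf_le_liminf ?_
  filter_upwards [h, eventually_ge_atTop 1] with x hx h1 using logRatio_mono h1 hx

theorem lowerExponent_le_upperExponent (N : ℝ → ℕ∞) : lowerExponent N ≤ upperExponent N :=
  liminf_le_limsup

theorem le_logRatio_of_rpow_le {N : ℝ → ℕ∞} {x t : ℝ} (hx : 1 < x)
    (h : ENNReal.ofReal (x ^ t) ≤ (N x : ℝ≥0∞)) : (t : EReal) ≤ logRatio N x := by
  have hl : 0 < Real.log x := Real.log_pos hx
  unfold logRatio
  rw [EReal.le_div_iff_mul_le (by exact_mod_cast hl) (EReal.coe_ne_top _)]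
  refine le_trans (le_of_eq ?_) (ENNReal.log_monotone h)
  rw [ENNReal.log_ofReal_of_pos (by positivity), Real.log_rpow (by positivity)]
  push_cast; rfl

theorem logRatio_le_of_le_rpow {N : ℝ → ℕ∞} {x t : ℝ} (hx : 1 < x)
    (h : (N x : ℝ≥0∞) ≤ ENNReal.ofReal (x ^ t)) : logRatio N x ≤ (t : EReal) := by
  have hl : 0 < Real.log x := Real.log_pos hx
  unfold logRatio
  rw [EReal.div_le_iff_le_mul (by exact_mod_cast hl) (EReal.coe_ne_top _)]
  refine le_trans (ENNReal.log_monotone h) (le_of_eq ?_)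
  rw [ENNReal.log_ofReal_of_pos (by positivity), Real.log_rpow (by positivity), mul_comm]
  push_cast; rfl

/-! ### Sums of powers -/

section PowerSum

variable {ι : Type*} {s : Finset ι} {r : ι → ℝ}

theorem strictAnti_sum_rpow (hs : s.Nonempty) (h0 : ∀ i ∈ s, 0 < r i) (h1 : ∀ i ∈ s, r i < 1) :
    StrictAnti fun q : ℝ => ∑ i ∈ s, r i ^ q := fun _ _ hpq =>
  Finset.sum_lt_sum_of_nonempty hs fun i hi =>
    Real.rpow_lt_rpow_of_exponent_gt (h0 i hi) (h1 i hi) hpq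

/-- At `q = 0` the sum is the number of terms, at least 1, and it decreases strictly to 0 as `q`
grows. -/
theorem existsUnique_sum_rpow_eq_one (hs : s.Nonempty) (h0 : ∀ i ∈ s, 0 < r i)
    (h1 : ∀ i ∈ s, r i < 1) : ∃! q : ℝ, ∑ i ∈ s, r i ^ q = 1 := by
  have hcont : Continuous fun q : ℝ => ∑ i ∈ s, r i ^ q :=
    continuous_finsetSum _ fun i hi => Real.continuous_const_rpow (h0 i hi).ne'
  have hlim : Tendsto (fun q : ℝ => ∑ i ∈ s, r i ^ q) atTop (nhds 0) := by
    have := tendsto_finsetSum s fun i (hi : i ∈ s) =>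
      tendsto_rpow_atTop_of_base_lt_one (r i) (by linarith [h0 i hi]) (h1 i hi)
    simpa using this
  obtain ⟨b, hb1, hb0⟩ :=
    ((hlim.eventually (gt_mem_nhds one_pos)).and (eventually_ge_atTop 0)).exists
  have hzero : (1 : ℝ) ≤ ∑ i ∈ s, r i ^ (0 : ℝ) := by
    simpa using hs.card_pos
  obtain ⟨q, -, hq⟩ := intermediate_value_Icc' hb0 hcont.continuousOn ⟨hb1.le, hzero⟩
  exact ⟨q, hq, fun p hp => (strictAnti_sum_rpow hs h0 h1).injective (hp.trans hq.symm)⟩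

end PowerSum

/-! ### Dyadic intervals -/

theorem measurableSet_dyadic (n k : ℕ) : MeasurableSet (dyadic n k) := measurableSet_Ioc

theorem dyadic_pairwiseDisjoint (n : ℕ) : Pairwise fun k l => Disjoint (dyadic n k) (dyadic n l) := by
  have key : ∀ k l : ℕ, k < l → Disjoint (dyadic n k) (dyadic n l) := by
    intro k l h
    rw [Set.disjoint_left]
    rintro y ⟨-, h1⟩ ⟨h2, -⟩
    have h3 : (l : ℝ) / 2 ^ n < ((k : ℝ) + 1) / 2 ^ n := h2.trans_le h1
    rw [div_lt_div_iff_of_pos_right (by positivity)] at h3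
    have : (l : ℝ) < ((k + 1 : ℕ) : ℝ) := by exact_mod_cast h3
    have := Nat.cast_lt.1 this
    omega
  intro k l hkl
  rcases lt_or_gt_of_ne hkl with h | h
  · exact key k l h
  · exact (key l k h).symm

theorem exists_mem_dyadic (n : ℕ) {y : ℝ} (h0 : 0 < y) (h1 : y ≤ 1) :
    ∃ k < 2 ^ n, y ∈ dyadic n k := by
  have hp : (0 : ℝ) < 2 ^ n := by positivity
  have hpos : 0 < ⌈y * 2 ^ n⌉₊ := Nat.ceil_pos.2 (by positivity)
  have hle : ⌈y * 2 ^ n⌉₊ ≤ 2 ^ n := by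
    apply Nat.ceil_le.2
    push_cast
    nlinarith
  have hcast : ((⌈y * 2 ^ n⌉₊ - 1 : ℕ) : ℝ) = (⌈y * 2 ^ n⌉₊ : ℝ) - 1 := by
    rw [Nat.cast_sub (by omega)]; simp
  -- Ceiling minus one rather than the floor, because the cells contain their right ends.
  refine ⟨⌈y * 2 ^ n⌉₊ - 1, by omega, ?_, ?_⟩
  · rw [hcast, div_lt_iff₀ hp]
    have := Nat.ceil_lt_add_one (a := y * 2 ^ n) (by positivity)
    linarith
  · rw [hcast, le_div_iff₀ hp]
    have := Nat.le_ceil (y * 2 ^ n)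
    linarith

theorem iUnion_dyadic (n : ℕ) : ⋃ k ∈ Finset.range (2 ^ n), dyadic n k = Ioc 0 1 := by
  ext y
  simp only [mem_iUnion, Finset.mem_range, exists_prop]
  constructor
  · rintro ⟨k, hk, h1, h2⟩
    refine ⟨lt_of_le_of_lt (by positivity) h1, h2.trans ?_⟩
    rw [div_le_one (by positivity)]
    exact_mod_cast hk
  · rintro ⟨h0, h1⟩
    exact exists_mem_dyadic n h0 h1

theorem eventually_measureReal_lt_two_pow (ν : Measure ℝ) :
    ∀ᶠ n : ℕ in atTop, 1 ≤ n ∧ ν.real univ < 2 ^ n :=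
  (eventually_ge_atTop 1).and
    ((tendsto_pow_atTop_atTop_of_one_lt (one_lt_two : (1 : ℝ) < 2)).eventually_gt_atTop _)

open Classical in
/-- The indices of the dyadic intervals of level `n` that are charged by `ν`. -/
def charged (ν : Measure ℝ) (n : ℕ) : Finset ℕ :=
  (Finset.range (2 ^ n)).filter fun k => 0 < ν (dyadic n k)

theorem charged_nonempty {ν : Measure ℝ} (hν : ν (Ioo (0 : ℝ) 1)ᶜ = 0) (hν0 : ν ≠ 0) (n : ℕ) :
    (charged ν n).Nonempty := by
  classical
  by_contra hne
  have hz : ∀ k ∈ Finset.range (2 ^ n), ν (dyadic n k) = 0 := by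
    intro k hk
    by_contra hk0
    exact hne ⟨k, Finset.mem_filter.2 ⟨hk, pos_iff_ne_zero.2 hk0⟩⟩
  apply hν0
  rw [← Measure.measure_univ_eq_zero]
  have h1 : (univ : Set ℝ) ⊆ (Ioo (0 : ℝ) 1)ᶜ ∪ ⋃ k ∈ Finset.range (2 ^ n), dyadic n k := by
    rw [iUnion_dyadic]
    intro y _
    by_cases hy : y ∈ Ioo (0 : ℝ) 1
    · exact Or.inr ⟨hy.1, hy.2.le⟩
    · exact Or.inl hy
  refine measure_mono_null h1 (measure_union_null hν ?_)
  exact (measure_biUnion_null_iff (Finset.countable_toSet _)).2 hz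

/-! ### The fixed points of `βₙ` as roots of a power sum -/

section Measure

variable (ν : Measure ℝ) [IsFiniteMeasure ν]

theorem measureReal_dyadic_le (n k : ℕ) : ν.real (dyadic n k) ≤ ν.real univ :=
  measureReal_mono (subset_univ _)

theorem sum_measureReal_dyadic_le (n : ℕ) :
    ∑ k ∈ Finset.range (2 ^ n), ν.real (dyadic n k) ≤ ν.real univ := by
  rw [← measureReal_biUnion_finset (fun k _ l _ h => dyadic_pairwiseDisjoint n h)
    (fun k _ => measurableSet_dyadic n k)]
  exact measureReal_mono (subset_univ _)

variable {ν}

theorem measureReal_pos_of_mem_charged {n k : ℕ} (hk : k ∈ charged ν n) :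
    0 < ν.real (dyadic n k) := by
  classical
  exact ENNReal.toReal_pos (Finset.mem_filter.1 hk).2.ne' (measure_ne_top _ _)

variable (ν) in
/-- `∑ (ν(C) Λ(C))^q` over the charged dyadic intervals of level `n`. -/
def dyadicSum (n : ℕ) (q : ℝ) : ℝ := ∑ k ∈ charged ν n, (ν.real (dyadic n k) / 2 ^ n) ^ q

/-- Multiplying `βₙ(q) = q` by `log 2ⁿ` and exponentiating gives `∑ ν(C)^q = 2^(nq)`; dividing by
the right side absorbs the length `2⁻ⁿ` into each term. -/
theorem lqBeta_eq_iff (hν : ν (Ioo (0 : ℝ) 1)ᶜ = 0) (hν0 : ν ≠ 0) {n : ℕ} (hn : 1 ≤ n) (q : ℝ) :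
    lqBeta ν n q = q ↔ dyadicSum ν n q = 1 := by
  classical
  have h2 : (1 : ℝ) < 2 ^ n := one_lt_pow₀ (by norm_num) (by omega)
  have hl : 0 < Real.log (2 ^ n) := Real.log_pos h2
  have hS : 0 < ∑ k ∈ charged ν n, ν.real (dyadic n k) ^ q :=
    Finset.sum_pos (fun k hk => Real.rpow_pos_of_pos (measureReal_pos_of_mem_charged hk) _)
      (charged_nonempty hν hν0 n)
  have hZ : dyadicSum ν n q = (∑ k ∈ charged ν n, ν.real (dyadic n k) ^ q) / (2 ^ n : ℝ) ^ q := by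
    unfold dyadicSum
    rw [Finset.sum_div]
    exact Finset.sum_congr rfl fun k hk => Real.div_rpow measureReal_nonneg (by positivity) _
  have hβ : lqBeta ν n q =
      1 / Real.log (2 ^ n) * Real.log (∑ k ∈ charged ν n, ν.real (dyadic n k) ^ q) := rfl
  have hp : (0 : ℝ) < (2 ^ n : ℝ) ^ q := by positivity
  rw [hZ, hβ, div_eq_one_iff_eq hp.ne', one_div, inv_mul_eq_iff_eq_mul₀ hl.ne', mul_comm,
    ← Real.log_rpow (by positivity)]
  exact ⟨fun h => Real.log_injOn_pos hS hp h, fun h => by rw [h]⟩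

theorem dyadicRatio_pos {n k : ℕ} (hk : k ∈ charged ν n) : 0 < ν.real (dyadic n k) / 2 ^ n :=
  div_pos (measureReal_pos_of_mem_charged hk) (by positivity)

theorem dyadicRatio_lt_one {n : ℕ} (hn : ν.real univ < 2 ^ n) (k : ℕ) :
    ν.real (dyadic n k) / 2 ^ n < 1 := by
  rw [div_lt_one (by positivity)]
  exact (measureReal_dyadic_le ν n k).trans_lt hn

theorem existsUnique_lqBeta_eq (hν : ν (Ioo (0 : ℝ) 1)ᶜ = 0) (hν0 : ν ≠ 0) {n : ℕ} (hn : 1 ≤ n)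
    (h : ν.real univ < 2 ^ n) : ∃! q : ℝ, lqBeta ν n q = q := by
  simp only [lqBeta_eq_iff hν hν0 hn]
  exact existsUnique_sum_rpow_eq_one (charged_nonempty hν hν0 n) (fun k hk => dyadicRatio_pos hk)
    fun k _ => dyadicRatio_lt_one h k

theorem dyadicSum_strictAnti (hν : ν (Ioo (0 : ℝ) 1)ᶜ = 0) (hν0 : ν ≠ 0) {n : ℕ}
    (h : ν.real univ < 2 ^ n) : StrictAnti (dyadicSum ν n) :=
  strictAnti_sum_rpow (charged_nonempty hν hν0 n) (fun _ hk => dyadicRatio_pos hk)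
    fun k _ => dyadicRatio_lt_one h k

theorem dyadicSum_lqFixedPoint (hν : ν (Ioo (0 : ℝ) 1)ᶜ = 0) (hν0 : ν ≠ 0) {n : ℕ} (hn : 1 ≤ n)
    (h : ν.real univ < 2 ^ n) : dyadicSum ν n (lqFixedPoint ν n) = 1 := by
  rw [← lqBeta_eq_iff hν hν0 hn]
  exact Classical.epsilon_spec (p := fun q : ℝ => lqBeta ν n q = q)
    (existsUnique_lqBeta_eq hν hν0 hn h).exists

theorem eventually_lqFixedPoint_lt_iff (hν : ν (Ioo (0 : ℝ) 1)ᶜ = 0) (hν0 : ν ≠ 0) :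
    ∀ᶠ n : ℕ in atTop, ∀ q, lqFixedPoint ν n < q ↔ dyadicSum ν n q < 1 := by
  filter_upwards [eventually_measureReal_lt_two_pow ν] with n hn q
  conv_rhs => rw [← dyadicSum_lqFixedPoint hν hν0 hn.1 hn.2]
  exact (dyadicSum_strictAnti hν hν0 hn.2).lt_iff_gt.symm

theorem upperFixedPoint_nonneg (hν : ν (Ioo (0 : ℝ) 1)ᶜ = 0) (hν0 : ν ≠ 0) :
    0 ≤ upperFixedPoint ν := by
  refine le_limsup_of_frequently_le (Eventually.frequently ?_)
  filter_upwards [eventually_lqFixedPoint_lt_iff hν hν0] with n hn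
  -- `dyadicSum` at 0 counts the charged cells, so it is not below 1.
  have : ¬ lqFixedPoint ν n < 0 := by
    rw [hn, dyadicSum]
    simpa using (charged_nonempty hν hν0 n).ne_empty
  exact_mod_cast not_lt.1 this

theorem upperFixedPoint_le_of_eventually {s : ℝ} (hν : ν (Ioo (0 : ℝ) 1)ᶜ = 0) (hν0 : ν ≠ 0)
    (h : ∀ᶠ n : ℕ in atTop, dyadicSum ν n s < 1) : upperFixedPoint ν ≤ (s : EReal) := by
  apply limsup_le_of_le
  · isBoundedDefault
  filter_upwards [h, eventually_lqFixedPoint_lt_iff hν hν0] with n h1 h2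
  exact_mod_cast ((h2 s).2 h1).le

theorem eventually_dyadicSum_lt_one {s : ℝ} (hν : ν (Ioo (0 : ℝ) 1)ᶜ = 0) (hν0 : ν ≠ 0)
    (h : upperFixedPoint ν < (s : EReal)) : ∀ᶠ n : ℕ in atTop, dyadicSum ν n s < 1 := by
  have h1 := eventually_lt_of_limsup_lt h
  filter_upwards [h1, eventually_lqFixedPoint_lt_iff hν hν0] with n h1 h2
  exact (h2 s).1 (by exact_mod_cast h1)

theorem dyadicSum_half_le (n : ℕ) : dyadicSum ν n (1 / 2) ≤ √(ν.real univ) := by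
  classical
  have h1 : dyadicSum ν n (1 / 2) =
      ∑ k ∈ charged ν n, √(ν.real (dyadic n k)) * √((2 ^ n : ℝ)⁻¹) := by
    refine Finset.sum_congr rfl fun k _ => ?_
    rw [← Real.sqrt_eq_rpow, div_eq_mul_inv, Real.sqrt_mul measureReal_nonneg]
  rw [h1]
  refine (Real.sum_sqrt_mul_sqrt_le _ (fun _ => measureReal_nonneg)
    (fun _ => by positivity)).trans ?_
  have h2 : ∑ k ∈ charged ν n, ν.real (dyadic n k) ≤ ν.real univ :=
    (Finset.sum_le_sum_of_subset_of_nonneg (Finset.filter_subset _ _)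
      fun _ _ _ => measureReal_nonneg).trans (sum_measureReal_dyadic_le ν n)
  have h3 : ∑ k ∈ charged ν n, (2 ^ n : ℝ)⁻¹ ≤ 1 := by
    rw [Finset.sum_const, nsmul_eq_mul, ← div_eq_mul_inv, div_le_one (by positivity)]
    have := Finset.card_filter_le (Finset.range (2 ^ n)) fun k => 0 < ν (dyadic n k)
    rw [Finset.card_range] at this
    exact_mod_cast this
  calc _ ≤ √(ν.real univ) * √1 := by gcongr
    _ = _ := by simp

/-- At exponent `1/2` the sum is bounded uniformly in `n` by Cauchy–Schwarz; raising the exponent to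
`z > 1/2` gains a factor `(c/2ⁿ)^(z - 1/2)`, which tends to 0. -/
theorem upperFixedPoint_le_half (hν : ν (Ioo (0 : ℝ) 1)ᶜ = 0) (hν0 : ν ≠ 0) :
    upperFixedPoint ν ≤ ((1 / 2 : ℝ) : EReal) := by
  refine EReal.le_of_forall_lt_iff_le.1 fun z hz => ?_
  have hz : (1 / 2 : ℝ) < z := by exact_mod_cast hz
  apply upperFixedPoint_le_of_eventually hν hν0
  set c := ν.real univ
  have hlim : Tendsto (fun n : ℕ => (c / 2 ^ n) ^ (z - 1 / 2) * √c) atTop (nhds 0) := by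
    have h1 : Tendsto (fun n : ℕ => c / 2 ^ n) atTop (nhds 0) :=
      tendsto_const_nhds.div_atTop (tendsto_pow_atTop_atTop_of_one_lt one_lt_two)
    have h2 := (h1.rpow_const (p := z - 1 / 2) (Or.inr (by linarith))).mul_const (√c)
    rwa [Real.zero_rpow (by linarith), zero_mul] at h2
  filter_upwards [hlim.eventually (gt_mem_nhds one_pos)] with n hn
  refine lt_of_le_of_lt ?_ hn
  calc dyadicSum ν n z
      = ∑ k ∈ charged ν n, (ν.real (dyadic n k) / 2 ^ n) ^ (z - 1 / 2) *
          (ν.real (dyadic n k) / 2 ^ n) ^ (1 / 2 : ℝ) := by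
        refine Finset.sum_congr rfl fun k hk => ?_
        rw [← Real.rpow_add (dyadicRatio_pos hk)]; ring_nf
    _ ≤ ∑ k ∈ charged ν n, (c / 2 ^ n) ^ (z - 1 / 2) *
          (ν.real (dyadic n k) / 2 ^ n) ^ (1 / 2 : ℝ) := by
        refine Finset.sum_le_sum fun k hk => ?_
        have := (dyadicRatio_pos hk).le
        have h3 := measureReal_dyadic_le ν n k
        gcongr
    _ = (c / 2 ^ n) ^ (z - 1 / 2) * dyadicSum ν n (1 / 2) := by rw [← Finset.mul_sum]; rfl
    _ ≤ _ := by
        gcongr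
        exact dyadicSum_half_le n

end Measure

section

/-! ### The coarse multifractal dimension and the fixed points -/

open Classical in
/-- The indices of the dyadic intervals of level `n` of measure at least `2^(-α n)`. -/
def coarseSet (ν : Measure ℝ) (α : ℝ) (n : ℕ) : Finset ℕ :=
  (Finset.range (2 ^ n)).filter fun k => (2 : ℝ) ^ (-(α * n)) ≤ ν.real (dyadic n k)

theorem card_coarseSet (ν : Measure ℝ) (α : ℝ) (n : ℕ) :
    (coarseSet ν α n).card = coarseCount ν α n := rfl

theorem mem_coarseSet {ν : Measure ℝ} {α : ℝ} {n k : ℕ} :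
    k ∈ coarseSet ν α n ↔ k < 2 ^ n ∧ (2 : ℝ) ^ (-(α * n)) ≤ ν.real (dyadic n k) := by
  simp [coarseSet]

theorem log_two_pow_pos {n : ℕ} (hn : 1 ≤ n) : 0 < Real.log ((2 : ℝ) ^ n) :=
  Real.log_pos (one_lt_pow₀ (by norm_num) (by omega))

theorem coarseRatio_nonneg (ν : Measure ℝ) (α : ℝ) (n : ℕ) : 0 ≤ coarseRatio ν α n :=
  div_nonneg Real.posLog_nonneg (Real.log_nonneg (one_le_pow₀ (by norm_num)))

theorem coarseCount_le_of_coarseRatio_le {ν : Measure ℝ} {α s : ℝ} {n : ℕ} (hn : 1 ≤ n)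
    (h : coarseRatio ν α n ≤ s) : (coarseCount ν α n : ℝ) ≤ 2 ^ (s * n) := by
  rcases Nat.eq_zero_or_pos (coarseCount ν α n) with h0 | h0
  · rw [h0]; simp only [Nat.cast_zero]; positivity
  have h1 : (1 : ℝ) ≤ coarseCount ν α n := by exact_mod_cast h0
  rw [coarseRatio, div_le_iff₀ (log_two_pow_pos hn),
    Real.posLog_eq_log (by rw [abs_of_nonneg (by linarith)]; exact h1)] at h
  rw [← Real.log_le_log_iff (by linarith) (by positivity), Real.log_rpow (by norm_num)]
  rw [Real.log_pow] at h
  linarith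

theorem coarseRatio_le_of_coarseCount_le {ν : Measure ℝ} {α s : ℝ} {n : ℕ} (hn : 1 ≤ n)
    (hs : 0 ≤ s) (h : (coarseCount ν α n : ℝ) ≤ 2 ^ (s * n)) : coarseRatio ν α n ≤ s := by
  rw [coarseRatio, div_le_iff₀ (log_two_pow_pos hn)]
  have h1 : (1 : ℝ) ≤ 2 ^ (s * n) := Real.one_le_rpow (by norm_num) (by positivity)
  refine (Real.posLog_le_posLog (by positivity) h).trans (le_of_eq ?_)
  rw [Real.posLog_eq_log (by rwa [abs_of_nonneg (by linarith)]), Real.log_rpow (by norm_num),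
    Real.log_pow]
  ring

theorem upperCoarseDim_nonneg (ν : Measure ℝ) : 0 ≤ upperCoarseDim ν := by
  refine le_trans ?_ (le_iSup₂ (1 : ℝ) one_pos)
  refine EReal.div_nonneg ?_ (by norm_num)
  refine le_limsup_of_frequently_le (Eventually.frequently (Eventually.of_forall fun n => ?_))
  exact_mod_cast coarseRatio_nonneg ν 1 n

theorem eventually_coarseCount_le {ν : Measure ℝ} {s α : ℝ} (hα : 0 < α) (h : upperCoarseDim ν < (s : EReal)) :
    ∀ᶠ n : ℕ in atTop, (coarseCount ν α n : ℝ) ≤ 2 ^ (s * (1 + α) * n) := by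
  have hp : (0 : EReal) < ((1 + α : ℝ) : EReal) := by
    exact_mod_cast (by linarith : (0 : ℝ) < 1 + α)
  have h1 : limsup (fun n : ℕ => ((coarseRatio ν α n : ℝ) : EReal)) atTop <
      ((s * (1 + α) : ℝ) : EReal) := by
    rw [EReal.coe_mul, ← EReal.div_lt_iff hp (EReal.coe_ne_top _)]
    exact lt_of_le_of_lt (le_iSup₂ (f := fun (α : ℝ) (_ : 0 < α) =>
      limsup (fun n : ℕ => ((coarseRatio ν α n : ℝ) : EReal)) atTop / ((1 + α : ℝ) : EReal)) α hα) h
  filter_upwards [eventually_lt_of_limsup_lt h1, eventually_ge_atTop 1] with n hn h2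
  exact coarseCount_le_of_coarseRatio_le h2 (by exact_mod_cast hn.le)

variable {ν : Measure ℝ} [IsFiniteMeasure ν]

theorem coarseSet_subset_charged (ν : Measure ℝ) [IsFiniteMeasure ν] (α : ℝ) (n : ℕ) :
    coarseSet ν α n ⊆ charged ν n := by
  classical
  intro k hk
  obtain ⟨h1, h2⟩ := mem_coarseSet.1 hk
  refine Finset.mem_filter.2 ⟨Finset.mem_range.2 h1, pos_iff_ne_zero.2 fun h0 => ?_⟩
  have : (0 : ℝ) < 2 ^ (-(α * n)) := by positivity
  rw [measureReal_def, h0] at h2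
  simp only [ENNReal.toReal_zero] at h2
  linarith

theorem two_rpow_div_pow (α : ℝ) (n : ℕ) (q : ℝ) :
    ((2 : ℝ) ^ (-(α * n)) / 2 ^ n) ^ q = 2 ^ (-(q * (1 + α) * n)) := by
  rw [← Real.rpow_natCast 2 n, ← Real.rpow_sub (by norm_num), ← Real.rpow_mul (by norm_num)]
  ring_nf

/-- Markov's inequality: a counted cell contributes at least `2^(-q(1+α)n)`. The `α` comes from the
mass and the 1 from the length, which explains the normalisation `1/(1+α)` of the coarse dimensions.
-/
theorem coarseCount_le_of_dyadicSum_le {α q : ℝ} (hq : 0 ≤ q) {n : ℕ}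
    (h : dyadicSum ν n q ≤ 1) : (coarseCount ν α n : ℝ) ≤ 2 ^ (q * (1 + α) * n) := by
  have h1 : (coarseCount ν α n : ℝ) * 2 ^ (-(q * (1 + α) * n)) ≤ 1 := by
    refine le_trans ?_ h
    rw [← card_coarseSet, ← nsmul_eq_mul, ← Finset.sum_const]
    refine (Finset.sum_le_sum fun k hk => ?_).trans
      (Finset.sum_le_sum_of_subset_of_nonneg (coarseSet_subset_charged ν α n)
        fun k hk _ => Real.rpow_nonneg (dyadicRatio_pos hk).le _)
    rw [← two_rpow_div_pow]
    have := (mem_coarseSet.1 hk).2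
    gcongr
  rw [Real.rpow_neg (by norm_num)] at h1
  have h2 : (0 : ℝ) < 2 ^ (q * (1 + α) * n) := by positivity
  rwa [← div_eq_mul_inv, div_le_one h2] at h1

theorem upperCoarseDim_le_upperFixedPoint (hν : ν (Ioo (0 : ℝ) 1)ᶜ = 0) (hν0 : ν ≠ 0) :
    upperCoarseDim ν ≤ upperFixedPoint ν := by
  refine iSup₂_le fun α hα => EReal.le_of_forall_lt_iff_le.1 fun z hz => ?_
  have hz0 : (0 : ℝ) ≤ z := by
    exact_mod_cast (upperFixedPoint_nonneg hν hν0).trans hz.le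
  rw [EReal.div_le_iff_le_mul (by exact_mod_cast (by linarith : (0 : ℝ) < 1 + α))
    (EReal.coe_ne_top _), ← EReal.coe_mul]
  apply limsup_le_of_le
  · isBoundedDefault
  filter_upwards [eventually_dyadicSum_lt_one hν hν0 hz, eventually_ge_atTop 1] with n hn h1
  have := coarseRatio_le_of_coarseCount_le h1 (by positivity)
    (coarseCount_le_of_dyadicSum_le (α := α) hz0 hn.le)
  rw [mul_comm]
  exact_mod_cast this

open Classical in
-- Layering by mass in steps of `δ`. Increasing `M` either adds exactly the previous tail term (the
-- cell has mass at least `2^(-(M+1)δn)`) or bounds the cell directly by the new tail term.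
theorem rpow_dyadicRatio_le_sum {K z δ : ℝ} (hz : 0 ≤ z) (hK1 : 1 ≤ K)
    (hK : ν.real univ ^ z ≤ K) {n k : ℕ} (hk : k < 2 ^ n) (M : ℕ) :
    (ν.real (dyadic n k) / 2 ^ n) ^ z ≤
      ∑ j ∈ Finset.range M, (if k ∈ coarseSet ν ((j + 1 : ℕ) * δ) n then
        K * 2 ^ (-(z * (1 + j * δ) * n)) else 0) + K * (2 : ℝ) ^ (-(z * (1 + M * δ) * n)) := by
  induction M with
  | zero =>
    rw [Real.div_rpow measureReal_nonneg (by positivity), ← Real.rpow_natCast 2 n,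
      ← Real.rpow_mul (by norm_num), div_eq_mul_inv, ← Real.rpow_neg (by norm_num)]
    simp only [Finset.range_zero, Finset.sum_empty, Nat.cast_zero, zero_mul, zero_add, add_zero,
      mul_one]
    rw [mul_comm (n : ℝ) z]
    gcongr
    refine le_trans ?_ hK
    have := measureReal_dyadic_le ν n k
    gcongr
  | succ M ih =>
    rw [Finset.sum_range_succ]
    by_cases hc : k ∈ coarseSet ν ((M + 1 : ℕ) * δ) n
    · rw [if_pos hc]
      have : 0 ≤ K * (2 : ℝ) ^ (-(z * (1 + (M + 1 : ℕ) * δ) * n)) := by positivity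
      linarith
    · rw [if_neg hc, add_zero]
      have h1 : ν.real (dyadic n k) ≤ 2 ^ (-(((M + 1 : ℕ) * δ) * n)) := by
        by_contra h
        exact hc (mem_coarseSet.2 ⟨hk, (not_le.1 h).le⟩)
      have h2 : (ν.real (dyadic n k) / 2 ^ n) ^ z ≤ 2 ^ (-(z * (1 + (M + 1 : ℕ) * δ) * n)) := by
        rw [← two_rpow_div_pow]
        gcongr
      have h3 : 0 ≤ ∑ j ∈ Finset.range M, (if k ∈ coarseSet ν ((j + 1 : ℕ) * δ) n then
          K * (2 : ℝ) ^ (-(z * (1 + j * δ) * n)) else 0) :=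
        Finset.sum_nonneg fun j _ => by split_ifs <;> positivity
      have h4 : (0 : ℝ) ≤ 2 ^ (-(z * (1 + (M + 1 : ℕ) * δ) * n)) := by positivity
      nlinarith

theorem dyadicSum_le_sum_coarseCount {K z δ : ℝ} (hz : 0 ≤ z) (hK1 : 1 ≤ K)
    (hK : ν.real univ ^ z ≤ K) (n M : ℕ) :
    dyadicSum ν n z ≤
      ∑ j ∈ Finset.range M, coarseCount ν ((j + 1 : ℕ) * δ) n * (K * 2 ^ (-(z * (1 + j * δ) * n)))
        + 2 ^ n * (K * (2 : ℝ) ^ (-(z * (1 + M * δ) * n))) := by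
  classical
  have h1 : dyadicSum ν n z ≤ ∑ k ∈ Finset.range (2 ^ n), (ν.real (dyadic n k) / 2 ^ n) ^ z :=
    Finset.sum_le_sum_of_subset_of_nonneg (Finset.filter_subset _ _) fun k _ _ => by positivity
  refine h1.trans ((Finset.sum_le_sum fun k hk =>
    rpow_dyadicRatio_le_sum (δ := δ) hz hK1 hK (Finset.mem_range.1 hk) M).trans (le_of_eq ?_))
  rw [Finset.sum_add_distrib, Finset.sum_const, Finset.card_range, nsmul_eq_mul, Finset.sum_comm]
  congr 1
  · refine Finset.sum_congr rfl fun j _ => ?_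
    rw [← Finset.sum_filter, Finset.sum_const, nsmul_eq_mul]
    congr 3
    ext k
    simp only [Finset.mem_filter, Finset.mem_range, mem_coarseSet]
    tauto
  · push_cast; rfl

/-- For `z` above the coarse dimension each of finitely many mass layers contributes an
exponentially small amount to `dyadicSum` at `z`, so the sum is eventually below 1. -/
theorem upperFixedPoint_le_upperCoarseDim (hν : ν (Ioo (0 : ℝ) 1)ᶜ = 0) (hν0 : ν ≠ 0) :
    upperFixedPoint ν ≤ upperCoarseDim ν := by
  refine EReal.le_of_forall_lt_iff_le.1 fun z hz => ?_
  apply upperFixedPoint_le_of_eventually hν hν0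
  obtain ⟨s, hs, hsz⟩ := EReal.lt_iff_exists_real_btwn.1 hz
  have hsz : s < z := by exact_mod_cast hsz
  have hs0 : 0 < s := by
    rcases (upperCoarseDim_nonneg ν).trans_lt hs with h
    exact_mod_cast h
  have hz0 : 0 < z := hs0.trans hsz
  set η := (z - s) / 2 with hη
  have hη0 : 0 < η := by rw [hη]; linarith
  -- Counting layer `j` at its lower threshold costs an extra `s δ = η` in the exponent, half of the
  -- available gap `z - s`; the other half is the decay rate.
  set δ := η / s with hδ
  have hδ0 : 0 < δ := by positivity
  have hsδ : s * δ = η := by rw [hδ]; field_simp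
  -- Enough layers that the tail term beats the total number `2ⁿ` of cells by `2^(ηn)`.
  obtain ⟨M, hM⟩ := exists_nat_ge ((1 + η) / (z * δ))
  have hM : 1 + η ≤ z * (1 + M * δ) := by
    rw [div_le_iff₀ (by positivity)] at hM
    nlinarith
  -- The heaviest layer has no upper threshold; its mass is bounded only by the total mass, which
  -- may exceed 1.
  set K := max 1 (ν.real univ ^ z) with hKdef
  have hK1 : 1 ≤ K := le_max_left _ _
  have hlim : Tendsto (fun n : ℕ => (M + 1 : ℝ) * K * (2 ^ (-η)) ^ n) atTop (nhds 0) := by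
    have h1 : (2 : ℝ) ^ (-η) < 1 := Real.rpow_lt_one_of_one_lt_of_neg (by norm_num) (by linarith)
    simpa using (tendsto_pow_atTop_nhds_zero_of_lt_one (by positivity) h1).const_mul
      ((M + 1 : ℝ) * K)
  have hc : ∀ᶠ n : ℕ in atTop, ∀ j ∈ Finset.range M,
      (coarseCount ν ((j + 1 : ℕ) * δ) n : ℝ) ≤ 2 ^ (s * (1 + (j + 1 : ℕ) * δ) * n) := by
    rw [Filter.eventually_all_finset]
    exact fun j _ => eventually_coarseCount_le (by positivity) hs
  filter_upwards [hlim.eventually (gt_mem_nhds one_pos), hc] with n hn hcn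
  refine lt_of_le_of_lt ((dyadicSum_le_sum_coarseCount (δ := δ) (by linarith) hK1
    (le_max_right _ _) n M).trans ?_) hn
  have hpow : ((2 : ℝ) ^ (-η)) ^ n = 2 ^ (-η * n) := by
    rw [Real.rpow_mul (by norm_num), Real.rpow_natCast]
  have hterm : ∀ j ∈ Finset.range M, (coarseCount ν ((j + 1 : ℕ) * δ) n : ℝ) *
      (K * 2 ^ (-(z * (1 + j * δ) * n))) ≤ K * (2 ^ (-η)) ^ n := by
    intro j hj
    calc _ ≤ (2 : ℝ) ^ (s * (1 + (j + 1 : ℕ) * δ) * n) * (K * 2 ^ (-(z * (1 + j * δ) * n))) := by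
          gcongr
          exact hcn j hj
      _ = K * 2 ^ (s * (1 + (j + 1 : ℕ) * δ) * n + -(z * (1 + j * δ) * n)) := by
          rw [Real.rpow_add (by norm_num)]; ring
      _ ≤ _ := by
          rw [hpow]
          gcongr
          · norm_num
          · have h5 : 0 ≤ (z - s) * (j * δ) := mul_nonneg (by linarith) (by positivity)
            have h6 : s * (1 + (j + 1 : ℕ) * δ) - z * (1 + j * δ) ≤ -η := by
              push_cast
              nlinarith
            nlinarith [Nat.cast_nonneg (α := ℝ) n]
  have hlast : (2 : ℝ) ^ n * (K * (2 : ℝ) ^ (-(z * (1 + M * δ) * n))) ≤ K * (2 ^ (-η)) ^ n := by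
    calc _ = K * 2 ^ ((n : ℝ) + -(z * (1 + M * δ) * n)) := by
          rw [Real.rpow_add (by norm_num), Real.rpow_natCast]; ring
      _ ≤ _ := by
          rw [hpow]
          gcongr
          · norm_num
          · nlinarith [Nat.cast_nonneg (α := ℝ) n]
  have hsum := Finset.sum_le_sum hterm
  rw [Finset.sum_const, Finset.card_range, nsmul_eq_mul] at hsum
  linarith

end

/-! ### Dyadic partitions -/

open Classical in
/-- The indices of the dyadic intervals `C` of level `n` with `ν(C) Λ(C) ≥ 1/x`. -/
def heavySet (ν : Measure ℝ) (x : ℝ) (n : ℕ) : Finset ℕ :=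
  (Finset.range (2 ^ n)).filter fun k => 1 / x ≤ ν.real (dyadic n k) / 2 ^ n

theorem mem_heavySet {ν : Measure ℝ} {x : ℝ} {n k : ℕ} :
    k ∈ heavySet ν x n ↔ k < 2 ^ n ∧ 1 / x ≤ ν.real (dyadic n k) / 2 ^ n := by
  simp [heavySet]

open Classical in
/-- The midpoints of the heavy dyadic intervals of level less than `L`, and the points `0`, `1`. -/
def heavyCuts (ν : Measure ℝ) (x : ℝ) (L : ℕ) : Finset ℝ :=
  {0, 1} ∪ (Finset.range L).biUnion fun n =>
    (heavySet ν x n).image fun k : ℕ => (2 * (k : ℝ) + 1) / 2 ^ (n + 1)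

theorem card_heavyCuts_le {ν : Measure ℝ} (x : ℝ) (L : ℕ) :
    (heavyCuts ν x L).card ≤ 2 + ∑ n ∈ Finset.range L, (heavySet ν x n).card := by
  classical
  unfold heavyCuts
  refine (Finset.card_union_le _ _).trans (Nat.add_le_add Finset.card_le_two ?_)
  exact Finset.card_biUnion_le.trans (Finset.sum_le_sum fun n _ => Finset.card_image_le)

theorem heavyCuts_bounds {ν : Measure ℝ} {x : ℝ} {L : ℕ} {s : ℝ} (hs : s ∈ heavyCuts ν x L) :
    0 ≤ s ∧ s ≤ 1 := by
  simp only [heavyCuts, Finset.mem_union, Finset.mem_insert, Finset.mem_singleton,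
    Finset.mem_biUnion, Finset.mem_image] at hs
  rcases hs with (rfl | rfl) | ⟨n, -, k, hk, rfl⟩
  · simp
  · simp
  · refine ⟨by positivity, ?_⟩
    rw [div_le_one (by positivity), pow_succ]
    have : (k : ℝ) + 1 ≤ 2 ^ n := by exact_mod_cast (mem_heavySet.1 hk).1
    linarith

/-! ### Partitions avoiding atoms -/

section Atoms

variable (ν : Measure ℝ) [IsFiniteMeasure ν]

theorem countable_atoms : {y : ℝ | 0 < ν {y}}.Countable :=
  Measure.countable_meas_pos_of_disjoint_iUnion (fun y => measurableSet_singleton y)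
    fun _ _ h => disjoint_singleton.2 h

theorem exists_mem_Ioo_not_atom {a b : ℝ} (hab : a < b) {t : Set ℝ} (ht : t.Countable) :
    ∃ d ∈ Ioo a b, ν {d} = 0 ∧ d ∉ t := by
  have h : ¬ Ioo a b ⊆ {y : ℝ | 0 < ν {y}} ∪ t := fun hsub =>
    (Cardinal.Real.Ioo_countable_iff.1 (((countable_atoms ν).union ht).mono hsub)).not_gt hab
  obtain ⟨d, hd, hn⟩ := Set.not_subset.1 h
  rw [mem_union, not_or] at hn
  exact ⟨d, hd, by simpa using hn.1, hn.2⟩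

theorem tendsto_measureReal_Ioc (a b : ℝ) :
    Tendsto (fun d => ν.real (Ioc a d)) (nhdsWithin b (Ioi b)) (nhds (ν.real (Ioc a b))) := by
  have h := tendsto_measure_biInter_gt (μ := ν) (s := fun d => Ioc a d) (a := b)
    (fun r _ => measurableSet_Ioc.nullMeasurableSet)
    (fun i j _ hij => Ioc_subset_Ioc_right hij) ⟨b + 1, by simp, measure_ne_top _ _⟩
  have h2 : ⋂ r > b, Ioc a r = Ioc a b := by
    ext y
    simp only [mem_iInter, mem_Ioc]
    constructor
    · intro hy
      exact ⟨(hy (b + 1) (by simp)).1, le_of_forall_gt_imp_ge_of_dense fun r hr => (hy r hr).2⟩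
    · rintro ⟨h1, h2⟩ r hr
      exact ⟨h1, h2.trans (le_of_lt hr)⟩
  rw [h2] at h
  exact (ENNReal.tendsto_toReal (measure_ne_top _ _)).comp h

variable {ν}

/-- Since `ν (a, d]` is right-continuous in `d`, the strict inequality survives a small move of the
cut to the right, and all but countably many positions carry no atom. -/
theorem exists_shifted_cut {ι : Type*} [Finite ι] {a b u t : ℝ} {f : ι → ℝ}
    (hf : ∀ i, b < f i) (hu : b < u) (h : ν.real (Ioc a b) * (b - a) < t) :
    ∃ d, b < d ∧ d < u ∧ ν {d} = 0 ∧ (∀ i, d < f i) ∧ ν.real (Ioc a d) * (d - a) < t := by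
  have h1 : ∀ᶠ d in nhdsWithin b (Ioi b), ν.real (Ioc a d) * (d - a) < t := by
    have hlim : Tendsto (fun d : ℝ => d - a) (nhdsWithin b (Ioi b)) (nhds (b - a)) :=
      ((continuous_id.sub continuous_const).tendsto b).mono_left nhdsWithin_le_nhds
    exact ((tendsto_measureReal_Ioc ν a b).mul hlim).eventually (gt_mem_nhds h)
  have h2 : ∀ᶠ d in nhdsWithin b (Ioi b), ∀ i, d < f i := by
    rw [eventually_all]
    exact fun i => eventually_nhdsWithin_of_eventually_nhds (gt_mem_nhds (hf i))
  obtain ⟨v, hv, hsub⟩ := (mem_nhdsGT_iff_exists_Ioo_subset' hu).1 (h1.and h2)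
  obtain ⟨d, hd, hd0, -⟩ := exists_mem_Ioo_not_atom ν (lt_min hv hu) countable_empty
  have hdv : d ∈ Ioo b v := ⟨hd.1, hd.2.trans_le (min_le_left _ _)⟩
  exact ⟨d, hd.1, hd.2.trans_le (min_le_right _ _), hd0, (hsub hdv).2, (hsub hdv).1⟩

/-- Cut points may be atoms here: each interior one is moved slightly to the right, staying before
the next. The ends 0 and 1 stay, as `ν` lives on the open interval. -/
theorem partitionCount_le_card (hν : ν (Ioo (0 : ℝ) 1)ᶜ = 0) {S : Finset ℝ} (h0 : 0 ∈ S)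
    (h1 : 1 ∈ S) (hS : ∀ s ∈ S, 0 ≤ s ∧ s ≤ 1) {x : ℝ}
    (hgap : ∀ a ∈ S, ∀ b ∈ S, a < b → (∀ c ∈ S, c ≤ a ∨ b ≤ c) →
      ν.real (Ioc a b) * (b - a) < 1 / x) :
    partitionCount ν x ≤ S.card := by
  obtain ⟨n, hn⟩ : ∃ n, S.card = n + 1 := ⟨S.card - 1, by have := Finset.card_pos.2 ⟨0, h0⟩; omega⟩
  set c := S.orderEmbOfFin hn with hc
  have hmem : ∀ i, c i ∈ S := fun i => Finset.orderEmbOfFin_mem S hn i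
  have hsurj : ∀ s ∈ S, ∃ i, c i = s := by
    intro s hs
    have : s ∈ Set.range c := by rw [hc, Finset.range_orderEmbOfFin]; exact hs
    exact this
  have hmono : StrictMono c := c.strictMono
  have hc0 : c 0 = 0 := by
    obtain ⟨i, hi⟩ := hsurj 0 h0
    exact le_antisymm (hi ▸ hmono.monotone (Fin.zero_le i)) (hS _ (hmem 0)).1
  have hcl : c (Fin.last n) = 1 := by
    obtain ⟨i, hi⟩ := hsurj 1 h1
    exact le_antisymm (hS _ (hmem _)).2 (hi ▸ hmono.monotone (Fin.le_last i))
  have hgap' : ∀ k : Fin n, ν.real (Ioc (c k.castSucc) (c k.succ)) *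
      (c k.succ - c k.castSucc) < 1 / x := by
    intro k
    refine hgap _ (hmem _) _ (hmem _) (hmono Fin.castSucc_lt_succ) fun s hs => ?_
    obtain ⟨i, rfl⟩ := hsurj s hs
    rcases le_or_gt i k.castSucc with hi | hi
    · exact Or.inl (hmono.monotone hi)
    · exact Or.inr (hmono.monotone (Fin.castSucc_lt_iff_succ_le.1 hi))
  have hnull : ∀ y : ℝ, y ∉ Ioo (0 : ℝ) 1 → ν {y} = 0 := fun y hy =>
    measure_mono_null (singleton_subset_iff.2 hy) hν
  have hex : ∀ i : Fin (n + 1), ∃ d, (i = 0 → d = 0) ∧ (i = Fin.last n → d = 1) ∧ ν {d} = 0 ∧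
      c i ≤ d ∧ (∀ j, i < j → d < c j) ∧ ∀ k : Fin n, k.succ = i →
        ν.real (Ioc (c k.castSucc) d) * (d - c k.castSucc) < 1 / x := by
    intro i
    rcases Fin.eq_zero_or_eq_succ i with rfl | ⟨k, rfl⟩
    · refine ⟨0, fun _ => rfl, fun h => ?_, hnull 0 (by simp), hc0.le, fun j hj => ?_,
        fun k hk => absurd hk (Fin.succ_ne_zero k)⟩
      · rw [← h, hc0] at hcl
        exact hcl
      · rw [← hc0]; exact hmono hj
    · by_cases hl : k.succ = Fin.last n
      · refine ⟨1, fun h => absurd h (Fin.succ_ne_zero k), fun _ => rfl, hnull 1 (by simp),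
          (hS _ (hmem _)).2, fun j hj => absurd hj (by rw [hl]; exact (Fin.le_last j).not_gt),
          fun l hlk => ?_⟩
        have := hgap' l
        rwa [hlk, hl, hcl] at this
      · obtain ⟨d, hd1, -, hd0, hd2, hd3⟩ := exists_shifted_cut (ν := ν)
          (f := fun j : {j // k.succ < j} => c j) (fun j => hmono j.2) (lt_add_one _) (hgap' k)
        refine ⟨d, fun h => absurd h (Fin.succ_ne_zero k), fun h => absurd h hl, hd0, hd1.le,
          fun j hj => hd2 ⟨j, hj⟩, fun l hlk => ?_⟩
        rw [Fin.succ_injective _ hlk]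
        exact hd3
  choose d hd0 hdl hdν hdc hdlt hdgap using hex
  have hdmono : StrictMono d := fun i j hij => (hdlt i j hij).trans_le (hdc j)
  refine le_trans (sInf_le ⟨n, d, rfl, ⟨hdmono, hd0 0 rfl, hdl _ rfl, hdν⟩, fun k => ?_⟩) ?_
  · have hlt : d k.castSucc < d k.succ := hdmono Fin.castSucc_lt_succ
    rw [Real.volume_real_Ioc_of_le hlt.le]
    -- Moving the left end to the right only shrinks the cell, so controlling the moved right end
    -- against the original left end suffices.
    refine lt_of_le_of_lt ?_ (hdgap k.succ k rfl)
    have hle := hdc k.castSucc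
    exact mul_le_mul (measureReal_mono (Ioc_subset_Ioc_left hle)) (by linarith) (by linarith)
      measureReal_nonneg
  · rw [hn]; exact_mod_cast Nat.le_succ n

/-- A gap between consecutive cuts that violated the bound would make every dyadic cell around it
heavy. The midpoint of such a cell is a cut, so the gap lies in one half; iterating reaches level
`L`, where no cell can be heavy. -/
theorem partitionCount_le_sum_heavySet (hν : ν (Ioo (0 : ℝ) 1)ᶜ = 0) {x : ℝ} {L : ℕ}
    (hL : ν.real univ / 2 ^ L < 1 / x) :
    partitionCount ν x ≤ ((2 + ∑ n ∈ Finset.range L, (heavySet ν x n).card : ℕ) : ℕ∞) := by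
  classical
  refine le_trans (partitionCount_le_card (S := heavyCuts ν x L) hν ?_ ?_ ?_ ?_)
    (by exact_mod_cast card_heavyCuts_le x L)
  · simp [heavyCuts]
  · simp [heavyCuts]
  · exact fun s hs => heavyCuts_bounds hs
  · intro a ha b hb hab hcons
    by_contra hJ
    rw [not_lt] at hJ
    have hheavy : ∀ n k : ℕ, k < 2 ^ n → (k : ℝ) / 2 ^ n ≤ a → b ≤ ((k : ℝ) + 1) / 2 ^ n →
        k ∈ heavySet ν x n := by
      intro n k hk h1 h2
      refine mem_heavySet.2 ⟨hk, hJ.trans ?_⟩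
      rw [div_eq_mul_inv]
      refine mul_le_mul (measureReal_mono (Ioc_subset_Ioc h1 h2)) ?_ (by linarith)
        measureReal_nonneg
      rw [add_div] at h2
      rw [← one_div]
      linarith
    have hdesc : ∀ n ≤ L, ∃ k : ℕ, k < 2 ^ n ∧ (k : ℝ) / 2 ^ n ≤ a ∧ b ≤ ((k : ℝ) + 1) / 2 ^ n := by
      intro n
      induction n with
      | zero =>
        intro _
        exact ⟨0, by simp, by simpa using (heavyCuts_bounds ha).1, by simpa using (heavyCuts_bounds hb).2⟩
      | succ n ih =>
        intro hn
        obtain ⟨k, hk, h1, h2⟩ := ih (by omega)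
        have hmid : (2 * (k : ℝ) + 1) / 2 ^ (n + 1) ∈ heavyCuts ν x L := by
          simp only [heavyCuts, Finset.mem_union, Finset.mem_biUnion, Finset.mem_image]
          exact Or.inr ⟨n, Finset.mem_range.2 (by omega), k, hheavy n k hk h1 h2, rfl⟩
        have e1 : (k : ℝ) / 2 ^ n = (2 * k) / 2 ^ (n + 1) := by rw [pow_succ]; field_simp
        have e2 : ((k : ℝ) + 1) / 2 ^ n = (2 * k + 1 + 1) / 2 ^ (n + 1) := by
          rw [pow_succ]; field_simp; ring
        rw [e1] at h1
        rw [e2] at h2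
        rcases hcons _ hmid with h | h
        · exact ⟨2 * k + 1, by rw [pow_succ]; omega, by push_cast; exact h, by push_cast; exact h2⟩
        · exact ⟨2 * k, by rw [pow_succ]; omega, by push_cast; exact h1, by push_cast; exact h⟩
    obtain ⟨k, hk, h1, h2⟩ := hdesc L le_rfl
    have h3 := (mem_heavySet.1 (hheavy L k hk h1 h2)).2
    have h4 : ν.real (dyadic L k) / 2 ^ L ≤ ν.real univ / 2 ^ L := by
      have := measureReal_dyadic_le ν L k
      gcongr
    linarith

theorem card_heavySet_le_rpow {q x : ℝ} (hq : 0 ≤ q) (hx : 0 < x) {n : ℕ}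
    (h : dyadicSum ν n q ≤ 1) : ((heavySet ν x n).card : ℝ) ≤ x ^ q := by
  classical
  have h1 : ((heavySet ν x n).card : ℝ) * (1 / x) ^ q ≤ 1 := by
    refine le_trans ?_ h
    rw [← nsmul_eq_mul, ← Finset.sum_const]
    refine (Finset.sum_le_sum fun k hk => ?_).trans
      (Finset.sum_le_sum_of_subset_of_nonneg (s := heavySet ν x n) (fun k hk => ?_)
        fun k hk _ => Real.rpow_nonneg (dyadicRatio_pos hk).le _)
    · have := (mem_heavySet.1 hk).2
      gcongr
    · obtain ⟨hk1, hk2⟩ := mem_heavySet.1 hk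
      refine Finset.mem_filter.2 ⟨Finset.mem_range.2 hk1, pos_iff_ne_zero.2 fun h0 => ?_⟩
      have : 0 < 1 / x := by positivity
      rw [measureReal_def, h0] at hk2
      simp only [ENNReal.toReal_zero, zero_div] at hk2
      linarith
  rw [one_div, Real.inv_rpow hx.le, ← div_eq_mul_inv, div_le_one (by positivity)] at h1
  exact h1

/-- Above level `n₀` each level has at most `x^q` heavy cells, and heavy cells disappear after
logarithmically many levels, so their total is below `x^s` for any `s > q`. -/
theorem upperEntropy_le_upperFixedPoint (hν : ν (Ioo (0 : ℝ) 1)ᶜ = 0) (hν0 : ν ≠ 0) :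
    upperEntropy ν ≤ upperFixedPoint ν := by
  refine EReal.le_of_forall_lt_iff_le.1 fun s hs => ?_
  obtain ⟨q, hq, hqs⟩ := EReal.lt_iff_exists_real_btwn.1 hs
  have hqs : q < s := by exact_mod_cast hqs
  have hq0 : 0 < q := by exact_mod_cast (upperFixedPoint_nonneg hν hν0).trans_lt hq
  obtain ⟨n₀, hn₀⟩ := eventually_atTop.1 (eventually_dyadicSum_lt_one hν hν0 hq)
  set ε := (s - q) / 2 with hε
  have hε0 : 0 < ε := by rw [hε]; linarith
  set c := ν.real univ
  have hc0 : 0 < c := by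
    have : NeZero ν := ⟨hν0⟩
    exact measureReal_univ_pos
  have hlog2 : 0 < Real.log 2 := Real.log_pos (by norm_num)
  have hlog : ∀ᶠ x : ℝ in atTop, Real.log x ≤ Real.log 2 / 2 * x ^ ε := by
    filter_upwards [(isLittleO_log_rpow_atTop hε0).bound (half_pos hlog2),
      eventually_ge_atTop 1] with x hx h1
    rw [Real.norm_of_nonneg (Real.log_nonneg h1), Real.norm_of_nonneg (by positivity)] at hx
    exact hx
  have htop : Tendsto (fun x : ℝ => x ^ ε) atTop atTop := tendsto_rpow_atTop hε0
  have hlogc : ∀ᶠ x : ℝ in atTop, Real.log c < Real.log 2 / 2 * x ^ ε :=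
    (htop.const_mul_atTop (half_pos hlog2)).eventually_gt_atTop _
  apply limsup_le_of_le
  · isBoundedDefault
  filter_upwards [hlog, hlogc, eventually_gt_atTop 1,
    htop.eventually_ge_atTop (4 + n₀ * 2 ^ n₀ : ℝ)] with x hx1 hx2 hx hx3
  apply logRatio_le_of_le_rpow hx
  have hx0 : 0 < x := by linarith
  -- Far more levels than the logarithm of `x` requires, but the power `x^ε` still fits into the gap
  -- `s - q = 2ε`.
  set L := ⌈x ^ ε⌉₊ with hL
  have hLx : x ^ ε ≤ L := Nat.le_ceil _
  have hcL : c / 2 ^ L < 1 / x := by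
    rw [div_lt_div_iff₀ (by positivity) hx0, one_mul,
      ← Real.log_lt_log_iff (by positivity) (by positivity), Real.log_mul hc0.ne' hx0.ne',
      Real.log_pow]
    nlinarith
  have h1 := partitionCount_le_sum_heavySet hν hcL
  have hbound : ∀ n ∈ Finset.range L, ((heavySet ν x n).card : ℝ) ≤
      x ^ q + if n < n₀ then 2 ^ n₀ else 0 := by
    intro n _
    split_ifs with hn
    · have h2 : (heavySet ν x n).card ≤ 2 ^ n := by
        classical
        exact (Finset.card_filter_le _ _).trans (by rw [Finset.card_range])
      have h3 : ((heavySet ν x n).card : ℝ) ≤ 2 ^ n₀ := by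
        exact_mod_cast h2.trans (Nat.pow_le_pow_right (by norm_num) hn.le)
      have : 0 ≤ x ^ q := by positivity
      linarith
    · rw [add_zero]
      exact card_heavySet_le_rpow hq0.le hx0 (hn₀ n (by omega)).le
  have hsum : ((2 + ∑ n ∈ Finset.range L, (heavySet ν x n).card : ℕ) : ℝ) ≤ x ^ s := by
    push_cast
    have h2 := Finset.sum_le_sum hbound
    rw [Finset.sum_add_distrib, Finset.sum_const, Finset.card_range, nsmul_eq_mul,
      ← Finset.sum_filter, Finset.sum_const, nsmul_eq_mul] at h2
    have h3 : (((Finset.range L).filter fun n => n < n₀).card : ℝ) ≤ n₀ := by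
      have : ((Finset.range L).filter fun n => n < n₀) ⊆ Finset.range n₀ := by
        intro n hn
        exact Finset.mem_range.2 (Finset.mem_filter.1 hn).2
      have := Finset.card_le_card this
      rw [Finset.card_range] at this
      exact_mod_cast this
    have h4 : (L : ℝ) ≤ x ^ ε + 1 := (Nat.ceil_lt_add_one (by positivity)).le
    have h5 : x ^ s = x ^ ε * (x ^ ε * x ^ q) := by
      rw [← Real.rpow_add hx0, ← Real.rpow_add hx0]
      congr 1
      rw [hε]; ring
    have h6 : 1 ≤ x ^ ε := Real.one_le_rpow hx.le hε0.le
    have h7 : 1 ≤ x ^ q := Real.one_le_rpow hx.le hq0.le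
    have h8 : x ^ q ≤ x ^ ε * x ^ q := by nlinarith
    -- The 4 collects the end points 0, 1 (two) and `L x^q ≤ (x^ε + 1) x^q` (two more); the other
    -- summand pays for the levels below `n₀`.
    have h9 : (4 + n₀ * 2 ^ n₀ : ℝ) * (x ^ ε * x ^ q) ≤ x ^ s := by
      rw [h5]
      gcongr
    have h10 : (((Finset.range L).filter fun n => n < n₀).card : ℝ) * 2 ^ n₀ ≤ n₀ * 2 ^ n₀ := by
      gcongr
    have h11 : (L : ℝ) * x ^ q ≤ (x ^ ε + 1) * x ^ q := by gcongr
    have h12 : (0 : ℝ) ≤ n₀ * 2 ^ n₀ := by positivity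
    have h13 : 1 ≤ x ^ ε * x ^ q := by nlinarith
    nlinarith
  have h2 : (partitionCount ν x : ℝ≥0∞) ≤
      ((2 + ∑ n ∈ Finset.range L, (heavySet ν x n).card : ℕ) : ℝ≥0∞) := by
    simpa only [ENat.toENNReal_coe] using ENat.toENNReal_le.2 h1
  refine h2.trans ?_
  rw [← ENNReal.ofReal_natCast]
  exact ENNReal.ofReal_le_ofReal hsum

end Atoms

/-! ### Disjoint families of enlarged dyadic intervals -/

theorem centered_sub_add (m c R : ℝ) : centered m (c - R) (c + R) = Icc (c - R / m) (c + R / m) := by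
  unfold centered
  congr 1
  · rw [show c + R - (c - R) = 2 * R by ring, mul_div_mul_left _ _ two_ne_zero]; ring
  · rw [show c + R - (c - R) = 2 * R by ring, mul_div_mul_left _ _ two_ne_zero]; ring

theorem rpow_le_coarseCount_of_lt_coarseRatio {ν : Measure ℝ} {α s : ℝ} (hs : 0 < s) {n : ℕ} (hn : 1 ≤ n)
    (h : s < coarseRatio ν α n) : (2 : ℝ) ^ (s * n) ≤ coarseCount ν α n := by
  by_contra hlt
  exact absurd (coarseRatio_le_of_coarseCount_le hn hs.le (not_le.1 hlt).le) (not_le.2 h)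

section

variable {ν : Measure ℝ} [IsFiniteMeasure ν]

variable (ν) in
-- Both the right end and its reflection in `c` have to avoid the countable set of atoms.
theorem exists_radius_not_atom (c : ℝ) {a b : ℝ} (hab : a < b) :
    ∃ R ∈ Ioo a b, ν {c - R} = 0 ∧ ν {c + R} = 0 := by
  have ht : {d : ℝ | 0 < ν {2 * c - d}}.Countable :=
    (countable_atoms ν).preimage_of_injOn (f := fun d : ℝ => 2 * c - d)
      (sub_right_injective.injOn)
  obtain ⟨d, hd, hd0, hdt⟩ := exists_mem_Ioo_not_atom ν (add_lt_add_right hab c) ht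
  refine ⟨d - c, ⟨by linarith [hd.1], by linarith [hd.2]⟩, ?_, ?_⟩
  · rw [show c - (d - c) = 2 * c - d by ring]; simpa using hdt
  · rw [add_sub_cancel]; exact hd0

/-- An interval centred at a point all of whose neighbourhoods are charged is admissible for large
`x`. This keeps the exponent away from `log 0 = -∞`. -/
theorem eventually_one_le_reducedCount (hν : ν (Ioo (0 : ℝ) 1)ᶜ = 0) (hν0 : ν ≠ 0) {m : ℝ}
    (hm : 1 < m) : ∀ᶠ x in atTop, 1 ≤ reducedCount ν m x := by
  have h1 : ν (Ioo (0 : ℝ) 1) ≠ 0 := by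
    intro h0
    apply hν0
    rw [← Measure.measure_univ_eq_zero, ← union_compl_self (Ioo (0 : ℝ) 1)]
    exact measure_union_null h0 hν
  obtain ⟨y, hy, hpos⟩ := exists_mem_forall_mem_nhdsWithin_pos_measure h1
  obtain ⟨R, hR, hR1, hR2⟩ := exists_radius_not_atom ν y (lt_min hy.1 (sub_pos.2 hy.2))
  have hRy := lt_min_iff.1 hR.2
  have hm0 : 0 < m := by linarith
  have hR0 : 0 < R := hR.1
  have hRm : 0 < R / m := div_pos hR0 hm0
  have hc : centered m (y - R) (y + R) = Icc (y - R / m) (y + R / m) := centered_sub_add m y R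
  have hν1 : 0 < ν.real (centered m (y - R) (y + R)) := by
    refine ENNReal.toReal_pos (hpos _ ?_).ne' (measure_ne_top _ _)
    rw [hc]
    exact mem_nhdsWithin_of_mem_nhds (Icc_mem_nhds (by linarith) (by linarith))
  have hv1 : 0 < volume.real (centered m (y - R) (y + R)) := by
    rw [hc, Real.volume_real_Icc_of_le (by linarith)]
    linarith
  have hlim : Tendsto (fun x : ℝ => 4 / (x * (m - 1))) atTop (nhds 0) :=
    tendsto_const_nhds.div_atTop (tendsto_id.atTop_mul_const (by linarith))
  filter_upwards [hlim.eventually (gt_mem_nhds (mul_pos hν1 hv1))] with x hx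
  refine le_sSup ⟨{(y - R, y + R)}, by simp, ⟨?_, by simp⟩, ?_⟩
  · intro p hp
    rw [Finset.mem_singleton] at hp
    subst hp
    exact ⟨by simp only; linarith, by simp only; linarith, by simp only; linarith, hR1, hR2⟩
  · intro p hp
    rw [Finset.mem_singleton] at hp
    subst hp
    exact hx.le

theorem card_le_reducedCount_of_residue {m x α : ℝ} (hm : 1 < m) (hm3 : m ≤ 3) {n i : ℕ}
    (hx : 4 / (x * (m - 1)) ≤ 2 ^ (-(α * n)) / 2 ^ n) {A : Finset ℕ}
    (hA : ∀ k ∈ A, 2 ≤ k ∧ k + 3 ≤ 2 ^ n ∧ k % 4 = i ∧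
      (2 : ℝ) ^ (-(α * n)) ≤ ν.real (dyadic n k)) :
    (A.card : ℕ∞) ≤ reducedCount ν m x := by
  classical
  have hp : (0 : ℝ) < 2 ^ n := by positivity
  set u : ℝ := 1 / 2 ^ n with hu
  have hu0 : 0 < u := by positivity
  set c : ℕ → ℝ := fun k => ((k : ℝ) + 1 / 2) * u with hc
  -- Radius above `3u/2` makes the `m`-centred part cover the dyadic cell when `m ≤ 3`; radius below
  -- `2u` keeps intervals disjoint when their indices differ by at least 4.
  have hex : ∀ k : ℕ, ∃ R ∈ Ioo (3 / 2 * u) (2 * u), ν {c k - R} = 0 ∧ ν {c k + R} = 0 :=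
    fun k => exists_radius_not_atom ν (c k) (by linarith)
  choose R hR hR1 hR2 using hex
  have hm0 : 0 < m := by linarith
  have hd : ∀ k : ℕ, dyadic n k = Ioc ((k : ℝ) * u) (((k : ℝ) + 1) * u) := fun k => by
    rw [dyadic, hu, mul_one_div, mul_one_div]
  have hgap : ∀ k ∈ A, ∀ l ∈ A, k < l → c k + R k < c l - R l := by
    intro k hk l hl hkl
    have h1 := (hA k hk).2.2.1
    have h2 := (hA l hl).2.2.1
    have h3 : k + 4 ≤ l := by omega
    have h4 : (k : ℝ) + 4 ≤ l := by exact_mod_cast h3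
    have h5 := (hR k).2
    have h6 := (hR l).2
    simp only [hc]
    nlinarith
  have hRpos : ∀ k, 0 < R k := fun k => by have := (hR k).1; linarith
  have hinj : Set.InjOn (fun k => (c k - R k, c k + R k)) (A : Set ℕ) := by
    intro k hk l hl hkl
    simp only [Prod.mk.injEq] at hkl
    rcases lt_trichotomy k l with h | h | h
    · have := hgap k hk l hl h
      have := hRpos k; have := hRpos l
      linarith [hkl.1]
    · exact h
    · have := hgap l hl k hk h
      have := hRpos k; have := hRpos l
      linarith [hkl.1]
  refine le_sSup ⟨A.image fun k => (c k - R k, c k + R k), ?_, ⟨?_, ?_⟩, ?_⟩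
  · rw [Finset.card_image_of_injOn hinj]
  · intro p hpA
    obtain ⟨k, hk, rfl⟩ := Finset.mem_image.1 hpA
    obtain ⟨hk1, hk2, -⟩ := hA k hk
    have h1 : (2 : ℝ) ≤ k := by exact_mod_cast hk1
    have h2 : (k : ℝ) + 3 ≤ 2 ^ n := by exact_mod_cast hk2
    have h3 : (2 : ℝ) ^ n * u = 1 := by rw [hu]; field_simp
    have h4 := (hR k).2
    have h5 := hRpos k
    refine ⟨?_, by simp only; linarith, ?_, hR1 k, hR2 k⟩
    · simp only [hc]; nlinarith
    · simp only [hc]; nlinarith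
  · intro p hpA q hqA hpq
    obtain ⟨k, hk, rfl⟩ := Finset.mem_image.1 (Finset.mem_coe.1 hpA)
    obtain ⟨l, hl, rfl⟩ := Finset.mem_image.1 (Finset.mem_coe.1 hqA)
    simp only [Function.onFun, Set.disjoint_left, mem_Ioc]
    rintro y ⟨hy1, hy2⟩ ⟨hy3, hy4⟩
    rcases lt_trichotomy k l with h | h | h
    · have := hgap k hk l hl h
      linarith
    · exact hpq (by rw [h])
    · have := hgap l hl k hk h
      linarith
  · intro p hpA
    obtain ⟨k, hk, rfl⟩ := Finset.mem_image.1 hpA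
    refine hx.trans ?_
    simp only [centered_sub_add]
    have h1 : 1 / 2 * u ≤ R k / m := by
      rw [le_div_iff₀ hm0]
      have := (hR k).1
      nlinarith
    rw [Real.volume_real_Icc_of_le (by linarith), div_eq_mul_one_div, ← hu]
    refine mul_le_mul ((hA k hk).2.2.2.trans (measureReal_mono ?_)) (by linarith) hu0.le
      measureReal_nonneg
    rw [hd]
    intro y hy
    simp only [hc]
    constructor
    · have := hy.1; linarith
    · have := hy.2; linarith

/-- Four residue classes give the factor 4. The additive 4 counts the two cells at each end, whose
enlargements might leave `[0,1]`. -/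
theorem coarseCount_le_reducedCount {m x α : ℝ} (hm : 1 < m) (hm3 : m ≤ 3) {n : ℕ}
    (hx : 4 / (x * (m - 1)) ≤ 2 ^ (-(α * n)) / 2 ^ n) :
    (coarseCount ν α n : ℕ∞) ≤ 4 + 4 * reducedCount ν m x := by
  classical
  set A := coarseSet ν α n with hA
  set Q := A.filter fun k => 2 ≤ k ∧ k + 3 ≤ 2 ^ n with hQ
  have h1 : A.card ≤ 4 + Q.card := by
    rw [← Finset.card_filter_add_card_filter_not (s := A) (fun k => 2 ≤ k ∧ k + 3 ≤ 2 ^ n),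
      add_comm]
    refine Nat.add_le_add_right ?_ _
    have hsub : (A.filter fun k => ¬ (2 ≤ k ∧ k + 3 ≤ 2 ^ n)) ⊆ {0, 1, 2 ^ n - 1, 2 ^ n - 2} := by
      intro k hk
      obtain ⟨hk1, hk2⟩ := Finset.mem_filter.1 hk
      have := (mem_coarseSet.1 hk1).1
      simp only [Finset.mem_insert, Finset.mem_singleton]
      omega
    exact (Finset.card_le_card hsub).trans Finset.card_le_four
  have h2 : Q.card = ∑ i ∈ Finset.range 4, (Q.filter fun k => k % 4 = i).card :=
    Finset.card_eq_sum_card_fiberwise fun k _ =>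
      Finset.mem_coe.2 (Finset.mem_range.2 (Nat.mod_lt k (by norm_num)))
  have h3 : ∀ i ∈ Finset.range 4,
      ((Q.filter fun k => k % 4 = i).card : ℕ∞) ≤ reducedCount ν m x := by
    intro i _
    refine card_le_reducedCount_of_residue (i := i) hm hm3 hx fun k hk => ?_
    obtain ⟨hk1, hk2⟩ := Finset.mem_filter.1 hk
    obtain ⟨hk3, hk4⟩ := Finset.mem_filter.1 hk1
    exact ⟨hk4.1, hk4.2, hk2, (mem_coarseSet.1 hk3).2⟩
  have h4 : (Q.card : ℕ∞) ≤ 4 * reducedCount ν m x := by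
    rw [h2]
    push_cast
    refine (Finset.sum_le_sum h3).trans ?_
    rw [Finset.sum_const, Finset.card_range, nsmul_eq_mul]
    rfl
  calc (coarseCount ν α n : ℕ∞) ≤ ((4 + Q.card : ℕ) : ℕ∞) := by exact_mod_cast h1
    _ = 4 + (Q.card : ℕ∞) := by push_cast; rfl
    _ ≤ _ := by gcongr

theorem rpow_le_reducedCount {m x α t z κ : ℝ} (hm : 1 < m) (hm3 : m ≤ 3) {n : ℕ} (hx : 1 < x)
    (hz : 0 ≤ z) (ht : 0 < t) (hκ : 0 < κ) (hn : (2 : ℝ) ^ ((1 + α) * n) ≤ x * (m - 1) / 4)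
    (hn' : κ * x ≤ (2 : ℝ) ^ ((1 + α) * n)) (hlarge : 8 ≤ κ ^ t * x ^ (t - z))
    (hc : (2 : ℝ) ^ (t * (1 + α) * n) ≤ coarseCount ν α n) :
    ENNReal.ofReal (x ^ z) ≤ (reducedCount ν m x : ℝ≥0∞) := by
  have hx0 : 0 < x := by linarith
  have h1 : 4 / (x * (m - 1)) ≤ 2 ^ (-(α * n)) / 2 ^ n := by
    have e : (2 : ℝ) ^ (-(α * n)) / 2 ^ n = 1 / 2 ^ ((1 + α) * n) := by
      rw [← Real.rpow_natCast 2 n, ← Real.rpow_sub (by norm_num), one_div,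
        ← Real.rpow_neg (by norm_num)]
      ring_nf
    rw [e, div_le_div_iff₀ (mul_pos hx0 (by linarith)) (by positivity)]
    linarith
  have h2 := coarseCount_le_reducedCount (ν := ν) hm hm3 h1
  rcases eq_or_ne (reducedCount ν m x) ⊤ with htop | htop
  · rw [htop]; simp
  lift reducedCount ν m x to ℕ using htop with N hN
  have h3 : (coarseCount ν α n : ℝ) ≤ 4 + 4 * N := by exact_mod_cast h2
  have h4 : (κ * x) ^ t ≤ (2 : ℝ) ^ (t * (1 + α) * n) := by
    rw [show t * (1 + α) * n = (1 + α) * n * t by ring, Real.rpow_mul (by norm_num)]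
    gcongr
  have h5 : (κ * x) ^ t = κ ^ t * x ^ (t - z) * x ^ z := by
    rw [Real.mul_rpow hκ.le hx0.le, mul_assoc, ← Real.rpow_add hx0]
    ring_nf
  have h6 : 1 ≤ x ^ z := Real.one_le_rpow hx.le hz
  -- The constant 8 is used here: `8 x^z ≤ 4 + 4N` and `1 ≤ x^z` give `x^z ≤ N`.
  have h7 : x ^ z ≤ N := by nlinarith
  rw [ENat.toENNReal_coe, ← ENNReal.ofReal_natCast]
  exact ENNReal.ofReal_le_ofReal h7

theorem lowerReducedEntropy_nonneg (hν : ν (Ioo (0 : ℝ) 1)ᶜ = 0) (hν0 : ν ≠ 0) {m : ℝ}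
    (hm : 1 < m) : 0 ≤ lowerReducedEntropy ν m := by
  apply le_liminf_of_le
  · isBoundedDefault
  filter_upwards [eventually_one_le_reducedCount hν hν0 hm, eventually_gt_atTop 1] with x h1 hx
  have h2 := ENat.toENNReal_le.2 h1
  exact_mod_cast le_logRatio_of_rpow_le (t := 0) hx (by simpa using h2)

theorem eventually_large {κ t z : ℝ} (hκ : 0 < κ) (htz : z < t) :
    ∀ᶠ x : ℝ in atTop, 8 ≤ κ ^ t * x ^ (t - z) :=
  ((tendsto_rpow_atTop (sub_pos.2 htz)).const_mul_atTop
    (Real.rpow_pos_of_pos hκ t)).eventually_ge_atTop 8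

/-- A lower limit has to be controlled at every large `x`, so each `x` is matched with the deepest
level `n` satisfying `2^((1+α)n) ≤ x(m-1)/4`. -/
theorem lowerCoarseDim_le_lowerReducedEntropy (hν : ν (Ioo (0 : ℝ) 1)ᶜ = 0) (hν0 : ν ≠ 0) {m : ℝ}
    (hm : 1 < m) (hm3 : m ≤ 3) : lowerCoarseDim ν ≤ lowerReducedEntropy ν m := by
  refine iSup₂_le fun α hα => EReal.ge_of_forall_gt_iff_ge.1 fun z hz => ?_
  rcases lt_or_ge z 0 with hz0 | hz0
  · exact le_trans (by exact_mod_cast hz0.le) (lowerReducedEntropy_nonneg hν hν0 hm)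
  obtain ⟨t, hzt, ht⟩ := EReal.lt_iff_exists_real_btwn.1 hz
  have hzt : z < t := by exact_mod_cast hzt
  have ht0 : 0 < t := by linarith
  have hα1 : 0 < 1 + α := by linarith
  rw [EReal.lt_div_iff (by exact_mod_cast hα1) (EReal.coe_ne_top _), ← EReal.coe_mul] at ht
  have hev : ∀ᶠ n : ℕ in atTop, (2 : ℝ) ^ (t * (1 + α) * n) ≤ coarseCount ν α n := by
    filter_upwards [eventually_lt_of_lt_liminf ht, eventually_ge_atTop 1] with n h1 h2
    exact rpow_le_coarseCount_of_lt_coarseRatio (by positivity) h2 (by exact_mod_cast h1)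
  have hm1 : 0 < m - 1 := by linarith
  -- Rounding the level down loses at most the factor `2^(1+α)`.
  set κ := (m - 1) / 4 / 2 ^ (1 + α) with hκ
  have hκ0 : 0 < κ := by positivity
  set f : ℝ → ℕ := fun x => ⌊Real.logb 2 (x * (m - 1) / 4) / (1 + α)⌋₊ with hf
  have hlin : Tendsto (fun x : ℝ => x * (m - 1) / 4) atTop atTop :=
    (tendsto_id.atTop_mul_const hm1).atTop_div_const (by norm_num)
  have hftop : Tendsto f atTop atTop :=
    tendsto_nat_floor_atTop.comp
      (((Real.tendsto_logb_atTop (by norm_num)).comp hlin).atTop_div_const hα1)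
  apply le_liminf_of_le
  · isBoundedDefault
  filter_upwards [eventually_gt_atTop 1, eventually_large hκ0 hzt, hftop.eventually hev,
    hlin.eventually_ge_atTop 1] with x hx h1 h2 h3
  apply le_logRatio_of_rpow_le hx
  have hy0 : 0 < x * (m - 1) / 4 := by linarith
  have hlog : 0 ≤ Real.logb 2 (x * (m - 1) / 4) / (1 + α) :=
    div_nonneg (Real.logb_nonneg (by norm_num) h3) hα1.le
  refine rpow_le_reducedCount hm hm3 hx hz0 ht0 hκ0 ?_ ?_ h1 h2
  · rw [← Real.le_logb_iff_rpow_le (by norm_num) hy0]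
    have := Nat.floor_le hlog
    rw [le_div_iff₀ hα1] at this
    linarith
  · have hlt := Nat.lt_floor_add_one (Real.logb 2 (x * (m - 1) / 4) / (1 + α))
    rw [div_lt_iff₀ hα1] at hlt
    have h4 : x * (m - 1) / 4 ≤ 2 ^ ((1 + α) * (f x : ℝ) + (1 + α)) := by
      rw [← Real.logb_le_iff_le_rpow (by norm_num) hy0]
      simp only [hf]
      linarith
    rw [Real.rpow_add (by norm_num)] at h4
    rw [hκ, div_mul_eq_mul_div, div_le_iff₀ (by positivity)]
    linarith

/-- For an upper limit it suffices to find large values along a sequence, so `x` is defined from `n`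
by equality in the level condition. -/
theorem upperCoarseDim_le_upperReducedEntropy (hν : ν (Ioo (0 : ℝ) 1)ᶜ = 0) (hν0 : ν ≠ 0) {m : ℝ}
    (hm : 1 < m) (hm3 : m ≤ 3) : upperCoarseDim ν ≤ upperReducedEntropy ν m := by
  refine iSup₂_le fun α hα => EReal.ge_of_forall_gt_iff_ge.1 fun z hz => ?_
  rcases lt_or_ge z 0 with hz0 | hz0
  · exact le_trans (by exact_mod_cast hz0.le) ((lowerReducedEntropy_nonneg hν hν0 hm).trans
      (lowerExponent_le_upperExponent _))
  obtain ⟨t, hzt, ht⟩ := EReal.lt_iff_exists_real_btwn.1 hz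
  have hzt : z < t := by exact_mod_cast hzt
  have ht0 : 0 < t := by linarith
  have hα1 : 0 < 1 + α := by linarith
  rw [EReal.lt_div_iff (by exact_mod_cast hα1) (EReal.coe_ne_top _), ← EReal.coe_mul] at ht
  have hm1 : 0 < m - 1 := by linarith
  set κ := (m - 1) / 4 with hκ
  have hκ0 : 0 < κ := by positivity
  have hx : Tendsto (fun n : ℕ => (2 : ℝ) ^ ((1 + α) * n) / κ) atTop atTop := by
    have h1 : Tendsto (fun n : ℕ => ((2 : ℝ) ^ (1 + α)) ^ n) atTop atTop :=
      tendsto_pow_atTop_atTop_of_one_lt (Real.one_lt_rpow (by norm_num) hα1)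
    refine (h1.atTop_div_const hκ0).congr fun n => ?_
    rw [Real.rpow_mul (by norm_num), Real.rpow_natCast]
  refine le_limsup_of_frequently_le (hx.frequently ?_)
  refine ((frequently_lt_of_lt_limsup (by isBoundedDefault) ht).and_eventually
    ((eventually_ge_atTop 1).and (hx.eventually ((eventually_gt_atTop 1).and
      (eventually_large hκ0 hzt))))).mono ?_
  rintro n ⟨h1, h2, h3, h4⟩
  refine le_logRatio_of_rpow_le h3 (rpow_le_reducedCount (α := α) hm hm3 h3 hz0 ht0 hκ0 ?_ ?_ h4
    (rpow_le_coarseCount_of_lt_coarseRatio (by positivity) h2 (by exact_mod_cast h1)))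
  · rw [mul_div_assoc, ← hκ, div_mul_cancel₀ _ hκ0.ne']
  · rw [mul_div_cancel₀ _ hκ0.ne']

end

/-! ### The variational principle for compact forms -/

section Variational

variable {H K : Type*} [NormedAddCommGroup H] [InnerProductSpace ℝ H] [CompleteSpace H]
  [NormedAddCommGroup K] [InnerProductSpace ℝ K] [CompleteSpace K]

/-- The nonzero solutions of `⟪v, g⟫ = l ⟪b v, b g⟫` with `l ≤ x`. -/
def formEigenvectors (b : H →L[ℝ] K) (x : ℝ) : Set H :=
  {v | v ≠ 0 ∧ ∃ l ≤ x, ∀ g, inner ℝ v g = l * inner ℝ (b v) (b g)}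

/-- The spectral radius of a self-adjoint operator is its norm, nonzero spectral values of a compact
operator are eigenvalues, and positivity excludes `-‖T‖`. -/
theorem exists_eigenvector_norm {T : H →L[ℝ] H} (hT : IsCompactOperator T)
    (hsymm : T.IsSymmetric) (hpos : ∀ v, 0 ≤ inner ℝ (T v) v) (h0 : T ≠ 0) :
    ∃ v, v ≠ 0 ∧ T v = ‖T‖ • v := by
  have hr := T.spectralRadius_eq_nnnorm hsymm.isSelfAdjoint
  have hne : (spectrum ℝ T).Nonempty := by
    by_contra he
    rw [Set.not_nonempty_iff_eq_empty] at he
    rw [spectralRadius, he] at hr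
    simp only [mem_empty_iff_false, not_false_eq_true, iSup_neg, bot_eq_zero', iSup_const] at hr
    exact h0 (nnnorm_eq_zero.1 (by exact_mod_cast hr.symm))
  obtain ⟨μ, hμ, hμr⟩ := spectrum.exists_nnnorm_eq_spectralRadius_of_nonempty hne
  rw [hr] at hμr
  have hμn : |μ| = ‖T‖ := by
    have : ‖μ‖₊ = ‖T‖₊ := by exact_mod_cast hμr
    simpa using congrArg NNReal.toReal this
  have hμ0 : μ ≠ 0 := by
    rintro rfl
    rw [abs_zero] at hμn
    exact h0 (norm_eq_zero.1 hμn.symm)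
  obtain ⟨v, hv⟩ := ((hT.hasEigenvalue_iff_mem_spectrum hμ0).2 hμ).exists_hasEigenvector
  have hv1 : T v = μ • v := hv.apply_eq_smul
  have hvpos : 0 < ‖v‖ ^ 2 := by have := norm_pos_iff.2 hv.2; positivity
  have hμnn : 0 ≤ μ := by
    have := hpos v
    rw [hv1, real_inner_smul_left, real_inner_self_eq_norm_sq] at this
    exact nonneg_of_mul_nonneg_left this hvpos
  refine ⟨v, hv.2, ?_⟩
  rw [hv1, ← hμn, abs_of_nonneg hμnn]

/-- If `W` were larger than the eigenvector span `V`, it would contain a nonzero `w` orthogonal to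
`V`. On `Vᗮ`, which `b*b` preserves, `w` forces the norm of `b*b` up to at least `1/x`; a top
eigenvector there is a form eigenvector with eigenvalue at most `x`, hence lies in both `V` and
`Vᗮ`. -/
theorem finrank_le_rank_formEigenvectors {b : H →L[ℝ] K} (hb : IsCompactOperator b) {x : ℝ}
    (hx : 0 < x) (W : Submodule ℝ H) [FiniteDimensional ℝ W]
    (hW : ∀ w ∈ W, ‖w‖ ^ 2 ≤ x * ‖b w‖ ^ 2) :
    (Module.finrank ℝ W : Cardinal) ≤
      Module.rank ℝ (Submodule.span ℝ (formEigenvectors b x)) := by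
  set V := Submodule.span ℝ (formEigenvectors b x) with hV
  by_contra! hlt
  have hfin : FiniteDimensional ℝ V :=
    Module.rank_lt_aleph0_iff.1 (hlt.trans (Cardinal.natCast_lt_aleph0))
  rw [← Module.finrank_eq_rank, Nat.cast_lt] at hlt
  obtain ⟨w, hwW, hwV, hw0⟩ : ∃ w ∈ W, w ∈ Vᗮ ∧ w ≠ 0 := by
    have hker := LinearMap.ker_ne_bot_of_finrank_lt
      (f := (V.orthogonalProjectionOnto : H →ₗ[ℝ] V) ∘ₗ W.subtype) hlt
    obtain ⟨w, hw, hw0⟩ := (Submodule.ne_bot_iff _).1 hker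
    refine ⟨w, w.2, ?_, by simpa using hw0⟩
    rw [LinearMap.mem_ker, LinearMap.comp_apply] at hw
    exact Submodule.orthogonalProjectionOnto_eq_zero_iff.1 hw
  set T : H →L[ℝ] H := (ContinuousLinearMap.adjoint b) ∘L b with hTdef
  have hTin : ∀ u g, inner ℝ (T u) g = inner ℝ (b u) (b g) := fun u g => by
    rw [hTdef, ContinuousLinearMap.comp_apply, ContinuousLinearMap.adjoint_inner_left]
  have hTc : IsCompactOperator T := hb.clm_comp (ContinuousLinearMap.adjoint b)
  have hinv : ∀ u ∈ Vᗮ, T u ∈ Vᗮ := by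
    intro u hu
    rw [Submodule.mem_orthogonal] at hu ⊢
    intro v hv
    induction hv using Submodule.span_induction with
    | mem v hv =>
      have huv := hu v (Submodule.subset_span hv)
      obtain ⟨hv0, l, -, hl⟩ := hv
      have hl0 : l ≠ 0 := by
        rintro rfl
        have := hl v
        rw [zero_mul, inner_self_eq_zero] at this
        exact hv0 this
      rw [hl u] at huv
      rw [real_inner_comm, hTin, real_inner_comm]
      exact (mul_eq_zero.1 huv).resolve_left hl0
    | zero => exact inner_zero_left _
    | add v₁ v₂ _ _ h₁ h₂ => rw [inner_add_left, h₁, h₂, add_zero]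
    | smul c v _ h => rw [real_inner_smul_left, h, mul_zero]
  let S : Vᗮ →L[ℝ] Vᗮ := T.restrict hinv
  have hSc : IsCompactOperator S := hTc.restrict' hinv
  have hSin : ∀ u g : Vᗮ, inner ℝ (S u) g = inner ℝ (b u) (b g) := fun u g => hTin u g
  have hSs : S.IsSymmetric := by
    intro u g
    change inner ℝ (S u) g = inner ℝ u (S g)
    rw [hSin, real_inner_comm, real_inner_comm (S g) u, hSin]
  have hSn : 1 / x ≤ ‖S‖ := by
    have hwpos : 0 < ‖w‖ ^ 2 := by have := norm_pos_iff.2 hw0; positivity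
    have h1 : ‖b w‖ ^ 2 ≤ ‖S‖ * ‖w‖ ^ 2 := by
      have h2 := hSin ⟨w, hwV⟩ ⟨w, hwV⟩
      rw [real_inner_self_eq_norm_sq] at h2
      rw [← h2]
      refine (real_inner_le_norm _ _).trans ?_
      have h3 := S.le_opNorm ⟨w, hwV⟩
      calc _ ≤ (‖S‖ * ‖(⟨w, hwV⟩ : Vᗮ)‖) * ‖(⟨w, hwV⟩ : Vᗮ)‖ := by gcongr
        _ = _ := by rw [Submodule.coe_norm]; ring
    have h4 := hW w hwW
    rw [div_le_iff₀ hx]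
    have h5 : ‖w‖ ^ 2 * 1 ≤ ‖w‖ ^ 2 * (‖S‖ * x) := by nlinarith
    exact le_of_mul_le_mul_left h5 hwpos
  have hSpos : 0 < ‖S‖ := lt_of_lt_of_le (by positivity) hSn
  obtain ⟨v, hv0, hv⟩ := exists_eigenvector_norm hSc hSs
    (fun v => by rw [hSin]; exact real_inner_self_nonneg) (norm_pos_iff.1 hSpos)
  have hvT : T v = ‖S‖ • (v : H) := congrArg Subtype.val hv
  have hvV : (v : H) ∈ V := by
    refine Submodule.subset_span ⟨by simpa using hv0, ‖S‖⁻¹, ?_, fun g => ?_⟩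
    · rw [inv_le_comm₀ hSpos hx, ← one_div]; exact hSn
    · rw [← hTin, hvT, real_inner_smul_left, inv_mul_cancel_left₀ hSpos.ne']
  apply hv0
  have := Submodule.inner_right_of_mem_orthogonal hvV v.2
  rw [inner_self_eq_zero] at this
  exact Subtype.ext this

end Variational

/-! ### Primitives of square integrable functions -/

/-- `L²([0,1])`, the space of weak derivatives. -/
abbrev L2I : Type := Lp ℝ 2 (volume.restrict (Icc (0 : ℝ) 1))

/-- The indicator function of `(p, q]` as an element of `L²([0,1])`. -/
def step (p q : ℝ) : L2I :=
  indicatorConstLp 2 (measurableSet_Ioc : MeasurableSet (Ioc p q)) (measure_ne_top _ _) 1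

theorem intervalIntegrable_of_memLp {g : ℝ → ℝ} (hg : MemLp g 2 (volume.restrict (Icc (0 : ℝ) 1)))
    {p q : ℝ} (hp : p ∈ Icc (0 : ℝ) 1) (hq : q ∈ Icc (0 : ℝ) 1) :
    IntervalIntegrable g volume p q := by
  have h1 : IntegrableOn g (Icc 0 1) := hg.integrable (by norm_num)
  exact (h1.mono_set (uIcc_subset_Icc hp hq)).intervalIntegrable

theorem L2I.intervalIntegrable (u : L2I) {p q : ℝ} (hp : p ∈ Icc (0 : ℝ) 1)
    (hq : q ∈ Icc (0 : ℝ) 1) : IntervalIntegrable u volume p q :=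
  intervalIntegrable_of_memLp (Lp.memLp u) hp hq

theorem inner_step {p q : ℝ} (hp : 0 ≤ p) (hpq : p ≤ q) (hq : q ≤ 1) (u : L2I) :
    inner ℝ (step p q) u = ∫ t in p..q, u t := by
  rw [step, L2.inner_indicatorConstLp_one, Measure.restrict_restrict measurableSet_Ioc,
    inter_eq_left.2 (Ioc_subset_Icc_self.trans (Icc_subset_Icc hp hq)),
    intervalIntegral.integral_of_le hpq]

theorem inner_step_step {p q : ℝ} (hp : 0 ≤ p) (hq : q ≤ 1) (r s : ℝ) :
    inner ℝ (step p q) (step r s) = max (min q s - max p r) 0 := by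
  rw [step, step, L2.real_inner_indicatorConstLp_one_indicatorConstLp_one, Ioc_inter_Ioc,
    measureReal_restrict_apply measurableSet_Ioc, inter_eq_left.2, Real.volume_real_Ioc]
  refine Ioc_subset_Icc_self.trans (Icc_subset_Icc ?_ ?_)
  · exact hp.trans (le_max_left _ _)
  · exact (min_le_left _ _).trans hq

/-- The primitive of `u` that vanishes at `0`. -/
def primitiveFun (u : L2I) : C(I, ℝ) where
  toFun x := ∫ t in (0 : ℝ)..x, u t
  continuous_toFun := by
    have h := intervalIntegral.continuousOn_primitive_interval'
      (u.intervalIntegrable (p := 0) (q := 1) (by simp) (by simp)) (a := 0) (by simp)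
    rw [uIcc_of_le zero_le_one] at h
    exact continuousOn_iff_continuous_domRestrict.1 h

theorem primitiveFun_apply (u : L2I) (x : I) : primitiveFun u x = ∫ t in (0 : ℝ)..x, u t := rfl

theorem primitiveFun_eq_inner (u : L2I) (x : I) :
    primitiveFun u x = inner ℝ (step 0 x) u := by
  rw [inner_step le_rfl x.2.1 x.2.2]; rfl

theorem primitiveFun_sub (u : L2I) {x y : I} (hxy : x ≤ y) :
    primitiveFun u y - primitiveFun u x = inner ℝ (step x y) u := by
  rw [inner_step x.2.1 hxy y.2.2, primitiveFun_apply, primitiveFun_apply]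
  exact intervalIntegral.integral_interval_sub_left
    (u.intervalIntegrable (by simp) y.2) (u.intervalIntegrable (by simp) x.2)

theorem norm_step {p q : ℝ} (hp : 0 ≤ p) (hpq : p ≤ q) (hq : q ≤ 1) : ‖step p q‖ = √(q - p) := by
  rw [← Real.sqrt_sq (norm_nonneg (step p q)), ← real_inner_self_eq_norm_sq,
    inner_step_step hp hq, min_self, max_self, max_eq_left (by linarith)]

/-- Hölder continuity with exponent `1/2`, from Cauchy–Schwarz against `step x y`; it supplies the
equicontinuity for Arzelà–Ascoli. -/
theorem dist_primitiveFun_le (u : L2I) (x y : I) :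
    dist (primitiveFun u x) (primitiveFun u y) ≤ √(dist x y) * ‖u‖ := by
  wlog hxy : x ≤ y generalizing x y
  · rw [dist_comm, dist_comm x y]
    exact this y x (le_of_not_ge hxy)
  have hxy' : (x : ℝ) ≤ y := hxy
  rw [dist_comm, Real.dist_eq, primitiveFun_sub u hxy]
  refine (abs_real_inner_le_norm _ _).trans (le_of_eq ?_)
  rw [norm_step x.2.1 hxy y.2.2, dist_comm, Subtype.dist_eq, Real.dist_eq,
    abs_of_nonneg (by linarith)]

/-- Taking primitives, as a continuous linear map. -/
def primitive : L2I →L[ℝ] C(I, ℝ) :=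
  LinearMap.mkContinuous
    { toFun := primitiveFun
      map_add' := fun u v => by
        ext x
        simp only [ContinuousMap.add_apply, primitiveFun_eq_inner, inner_add_right]
      map_smul' := fun c u => by
        ext x
        simp only [ContinuousMap.smul_apply, primitiveFun_eq_inner, inner_smul_right,
          RingHom.id_apply, smul_eq_mul] } 1 fun u => by
    rw [ContinuousMap.norm_le _ (by positivity)]
    intro x
    simp only [LinearMap.coe_mk, AddHom.coe_mk, primitiveFun_eq_inner, Real.norm_eq_abs]
    refine (abs_real_inner_le_norm _ _).trans ?_
    rw [norm_step le_rfl x.2.1 x.2.2]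
    gcongr
    rw [Real.sqrt_le_one]
    linarith [x.2.2]

theorem primitive_apply (u : L2I) (x : I) : primitive u x = ∫ t in (0 : ℝ)..x, u t := rfl

theorem primitive_eq_inner (u : L2I) (x : I) : primitive u x = inner ℝ (step 0 x) u :=
  primitiveFun_eq_inner u x

theorem primitive_sub (u : L2I) {x y : I} (hxy : x ≤ y) :
    primitive u y - primitive u x = inner ℝ (step x y) u := primitiveFun_sub u hxy

theorem primitive_zero (u : L2I) : primitive u 0 = 0 := by
  rw [primitive_apply]; simp

/-- Lebesgue differentiation of the primitive, which is constantly 0. Uniqueness of weak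
derivatives, and hence independence of the choice in `weakDeriv`, follows. -/
theorem ae_eq_zero_of_forall_integral_eq_zero {g : ℝ → ℝ}
    (hg : MemLp g 2 (volume.restrict (Icc (0 : ℝ) 1)))
    (h : ∀ x : I, ∫ t in (0 : ℝ)..x, g t = 0) : g =ᵐ[volume.restrict (Icc (0 : ℝ) 1)] 0 := by
  have h1 := (intervalIntegrable_of_memLp hg (p := 0) (q := 1) (by simp)
    (by simp)).ae_hasDerivAt_integral
  rw [restrict_Ioo_eq_restrict_Icc.symm, Filter.EventuallyEq, ae_restrict_iff' measurableSet_Ioo]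
  filter_upwards [h1] with x hx hx01
  have h2 := hx (by rw [uIcc_of_le zero_le_one]; exact Ioo_subset_Icc_self hx01) 0 (by simp)
  have h3 : (fun y => ∫ t in (0 : ℝ)..y, g t) =ᶠ[nhds x] fun _ => 0 := by
    filter_upwards [Ioo_mem_nhds hx01.1 hx01.2] with y hy
    exact h ⟨y, Ioo_subset_Icc_self hy⟩
  exact (h2.congr_of_eventuallyEq h3.symm).unique (hasDerivAt_const x (0 : ℝ))

theorem primitive_injective : Function.Injective primitive := by
  rw [injective_iff_map_eq_zero]
  intro u hu
  refine (Lp.eq_zero_iff_ae_eq_zero).2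
    (ae_eq_zero_of_forall_integral_eq_zero (Lp.memLp u) fun x => ?_)
  rw [← primitive_apply, hu]; rfl

/-! ### Weak derivatives -/

theorem HasWeakDeriv.ae_eq {f : C(I, ℝ)} {g h : ℝ → ℝ} (hg : HasWeakDeriv f g)
    (hh : HasWeakDeriv f h) : g =ᵐ[volume.restrict (Icc (0 : ℝ) 1)] h := by
  have h1 := ae_eq_zero_of_forall_integral_eq_zero (hg.1.sub hh.1) fun x => by
    have e : ∫ t in (0 : ℝ)..x, (g - h) t = (∫ t in (0 : ℝ)..x, g t) - ∫ t in (0 : ℝ)..x, h t :=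
      intervalIntegral.integral_sub (intervalIntegrable_of_memLp hg.1 (by simp) x.2)
        (intervalIntegrable_of_memLp hh.1 (by simp) x.2)
    rw [e]
    have h2 := hg.2 x
    have h3 := hh.2 x
    linarith
  filter_upwards [h1] with t ht
  exact sub_eq_zero.1 ht

theorem hasWeakDeriv_primitive (u : L2I) : HasWeakDeriv (primitive u) u :=
  ⟨Lp.memLp u, fun x => by rw [primitive_zero, zero_add]; rfl⟩

theorem weakDeriv_primitive_ae_eq (u : L2I) :
    weakDeriv (primitive u) =ᵐ[volume.restrict (Icc (0 : ℝ) 1)] u :=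
  (Classical.epsilon_spec (p := HasWeakDeriv (primitive u))
    ⟨_, hasWeakDeriv_primitive u⟩).ae_eq (hasWeakDeriv_primitive u)

theorem energy_primitive (u v : L2I) : energy (primitive u) (primitive v) = inner ℝ u v := by
  rw [energy, L2.inner_def]
  refine integral_congr_ae ?_
  filter_upwards [weakDeriv_primitive_ae_eq u, weakDeriv_primitive_ae_eq v] with t h1 h2
  rw [h1, h2]
  exact mul_comm _ _

theorem memH10_iff {f : C(I, ℝ)} : MemH10 f ↔ ∃ u, primitive u 1 = 0 ∧ primitive u = f := by
  constructor
  · rintro ⟨⟨g, hg, hgf⟩, h0, h1⟩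
    have e : primitive (hg.toLp g) = f := by
      ext x
      rw [primitive_apply, hgf x, h0, zero_add]
      refine intervalIntegral.integral_congr_ae_restrict ?_
      refine ae_restrict_of_ae_restrict_of_subset ?_ hg.coeFn_toLp
      rw [uIoc_of_le x.2.1]
      exact Ioc_subset_Icc_self.trans (Icc_subset_Icc_right x.2.2)
    exact ⟨hg.toLp g, by rw [e, h1], e⟩
  · rintro ⟨u, hu, rfl⟩
    exact ⟨⟨u, hasWeakDeriv_primitive u⟩, primitive_zero u, hu⟩

/-! ### Compactness -/

theorem isCompactOperator_primitive : IsCompactOperator primitive := by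
  let e := ContinuousMap.linearIsometryBoundedOfCompact I ℝ ℝ
  let G : L2I →L[ℝ] BoundedContinuousFunction I ℝ :=
    (e.toContinuousLinearEquiv : C(I, ℝ) →L[ℝ] BoundedContinuousFunction I ℝ) ∘L primitive
  have hG : IsCompactOperator G := by
    have := (isCompactOperator_iff_isCompact_closure_image_closedBall (𝕜₁ := ℝ)
      (G : L2I →ₗ[ℝ] BoundedContinuousFunction I ℝ) (r := 1) one_pos).2
    refine this ?_
    refine BoundedContinuousFunction.arzela_ascoli (Icc (-1) 1) isCompact_Icc _ ?_ ?_
    · rintro f x ⟨u, hu, rfl⟩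
      have h1 : |primitive u x| ≤ ‖step 0 (x : ℝ)‖ * ‖u‖ := by
        rw [primitive_eq_inner]; exact abs_real_inner_le_norm _ _
      rw [norm_step le_rfl x.2.1 x.2.2] at h1
      have h2 : ‖u‖ ≤ 1 := by simpa using hu
      have h3 : √((x : ℝ) - 0) ≤ 1 := by rw [Real.sqrt_le_one]; linarith [x.2.2]
      exact abs_le.1 (h1.trans (mul_le_one₀ h3 (norm_nonneg _) h2))
    · refine Metric.equicontinuous_of_continuity_modulus (fun t => √t) ?_ _ ?_
      · simpa using Real.continuous_sqrt.tendsto 0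
      · rintro x y ⟨f, u, hu, rfl⟩
        have h2 : ‖u‖ ≤ 1 := by simpa using hu
        refine (dist_primitiveFun_le u x y).trans ?_
        exact mul_le_of_le_one_right (Real.sqrt_nonneg _) h2
  have h := hG.clm_comp
    (e.symm.toContinuousLinearEquiv : BoundedContinuousFunction I ℝ →L[ℝ] C(I, ℝ))
  exact h

/-! ### Rayleigh quotients on the span of eigenvectors -/

section Span

variable {H K : Type*} [NormedAddCommGroup H] [InnerProductSpace ℝ H]
  [NormedAddCommGroup K] [InnerProductSpace ℝ K]

/-- The solutions of `⟪v, g⟫ = l ⟪b v, b g⟫` for a fixed `l`. -/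
def formEigenspace (b : H →L[ℝ] K) (l : ℝ) : Submodule ℝ H where
  carrier := {v | ∀ g, inner ℝ v g = l * inner ℝ (b v) (b g)}
  zero_mem' := fun g => by simp
  add_mem' := fun {v w} hv hw g => by
    rw [inner_add_left, map_add, inner_add_left, hv g, hw g]; ring
  smul_mem' := fun c v hv g => by
    rw [real_inner_smul_left, map_smul, real_inner_smul_left, hv g]; ring

/-- Grouped by eigenvalue, the components of `u` are mutually orthogonal for both inner products, so
each side is a sum over eigenvalues `l ≤ x` and the inequality is termwise. -/
theorem norm_sq_le_of_mem_span_formEigenvectors {b : H →L[ℝ] K} {x : ℝ} {u : H}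
    (hu : u ∈ Submodule.span ℝ (formEigenvectors b x)) : ‖u‖ ^ 2 ≤ x * ‖b u‖ ^ 2 := by
  have hle : Submodule.span ℝ (formEigenvectors b x) ≤
      ⨆ l : {l : ℝ // l ≤ x}, formEigenspace b l := by
    rw [Submodule.span_le]
    rintro v ⟨-, l, hl, hv⟩
    exact Submodule.mem_iSup_of_mem (p := fun l : {l : ℝ // l ≤ x} => formEigenspace b l)
      ⟨l, hl⟩ hv
  obtain ⟨f, hf, rfl⟩ := (Submodule.mem_iSup_iff_exists_finsupp _ _).1 (hle hu)
  have horth : ∀ l l' : {l : ℝ // l ≤ x}, l ≠ l' → inner ℝ (b (f l)) (b (f l')) = 0 := by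
    intro l l' hne
    have h1 := hf l (f l')
    have h2 := hf l' (f l)
    rw [real_inner_comm, real_inner_comm (b (f l))] at h2
    have h3 : ((l : ℝ) - l') * inner ℝ (b (f l)) (b (f l')) = 0 := by
      rw [sub_mul]; linarith
    exact (mul_eq_zero.1 h3).resolve_left (sub_ne_zero.2 fun h => hne (Subtype.ext h))
  have hb : ‖b (∑ i ∈ f.support, f i)‖ ^ 2 = ∑ l ∈ f.support, ‖b (f l)‖ ^ 2 := by
    rw [← real_inner_self_eq_norm_sq, map_sum, sum_inner]
    refine Finset.sum_congr rfl fun l hl => ?_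
    rw [inner_sum, Finset.sum_eq_single l, real_inner_self_eq_norm_sq]
    · exact fun l' _ hne => horth l l' hne.symm
    · exact fun h => absurd hl h
  have hn : ‖∑ i ∈ f.support, f i‖ ^ 2 = ∑ l ∈ f.support, (l : ℝ) * ‖b (f l)‖ ^ 2 := by
    rw [← real_inner_self_eq_norm_sq, sum_inner]
    refine Finset.sum_congr rfl fun l hl => ?_
    rw [inner_sum, Finset.sum_eq_single l, hf l (f l), real_inner_self_eq_norm_sq]
    · exact fun l' _ hne => by rw [hf l (f l'), horth l l' hne.symm, mul_zero]
    · exact fun h => absurd hl h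
  rw [Finsupp.sum, hb, hn, Finset.mul_sum]
  exact Finset.sum_le_sum fun l _ => mul_le_mul_of_nonneg_right l.2 (by positivity)

end Span

/-! ### The domain of the form as a Hilbert space -/

section Domain

variable (ν : Measure ℝ)

instance [IsFiniteMeasure ν] : IsFiniteMeasure (ν.comap (Subtype.val : I → ℝ)) :=
  ⟨by
    rw [comap_subtype_coe_apply measurableSet_Icc]
    exact measure_lt_top _ _⟩

/-- The weak derivatives of the elements of the domain of the form. -/
def formDomain : Submodule ℝ L2I where
  carrier := {u | primitive u 1 = 0 ∧ AffineOffSupport ν (primitive u)}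
  zero_mem' := ⟨by simp, fun x _ => ⟨0, 0, fun y _ => by simp⟩⟩
  add_mem' := fun {u v} hu hv => by
    refine ⟨by rw [map_add, ContinuousMap.add_apply, hu.1, hv.1, add_zero], fun x hx => ?_⟩
    obtain ⟨a, b, h⟩ := hu.2 x hx
    obtain ⟨a', b', h'⟩ := hv.2 x hx
    refine ⟨a + a', b + b', fun y hy => ?_⟩
    rw [map_add, ContinuousMap.add_apply, h y hy, h' y hy]; ring
  smul_mem' := fun c u hu => by
    refine ⟨by rw [map_smul, ContinuousMap.smul_apply, hu.1, smul_zero], fun x hx => ?_⟩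
    obtain ⟨a, b, h⟩ := hu.2 x hx
    refine ⟨c * a, c * b, fun y hy => ?_⟩
    rw [map_smul, ContinuousMap.smul_apply, h y hy, smul_eq_mul]; ring

theorem memDom_iff {f : C(I, ℝ)} : MemDom ν f ↔ ∃ u ∈ formDomain ν, primitive u = f := by
  rw [MemDom, memH10_iff]
  constructor
  · rintro ⟨⟨u, hu, rfl⟩, ha⟩
    exact ⟨u, ⟨hu, ha⟩, rfl⟩
  · rintro ⟨u, hu, rfl⟩
    exact ⟨⟨u, hu.1, rfl⟩, hu.2⟩

variable [IsFiniteMeasure ν]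

/-- The primitive, viewed in `L²(ν)`. -/
def embed : L2I →L[ℝ] Lp ℝ 2 (ν.comap (Subtype.val : I → ℝ)) :=
  ContinuousMap.toLp 2 (ν.comap (Subtype.val : I → ℝ)) ℝ ∘L primitive

theorem inner_embed (u v : L2I) :
    inner ℝ (embed ν u) (embed ν v) = innerL2 ν (primitive u) (primitive v) := by
  rw [embed, ContinuousLinearMap.comp_apply, ContinuousLinearMap.comp_apply,
    ContinuousMap.inner_toLp, innerL2]
  exact integral_congr_ae (Eventually.of_forall fun x => mul_comm _ _)

/-- The embedding of the domain into `L²(ν)`. -/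
def embedDom : formDomain ν →L[ℝ] Lp ℝ 2 (ν.comap (Subtype.val : I → ℝ)) :=
  embed ν ∘L (formDomain ν).subtypeL

/-- Taking primitives is injective and carries the `L²` inner product to the energy, so it matches
abstract form eigenvectors with eigenfunctions. -/
theorem eigenvalueCount_eq (x : ℝ) :
    eigenvalueCount ν x = Cardinal.toENat
      (Module.rank ℝ (Submodule.span ℝ (formEigenvectors (embedDom ν) x))) := by
  let Φ : formDomain ν →ₗ[ℝ] C(I, ℝ) := (primitive : L2I →ₗ[ℝ] C(I, ℝ)) ∘ₗ (formDomain ν).subtype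
  have hΦ : Function.Injective Φ := primitive_injective.comp Subtype.val_injective
  have hset : {f : C(I, ℝ) | ∃ l : ℝ, l ≤ x ∧ IsEigenfunction ν l f} =
      Φ '' formEigenvectors (embedDom ν) x := by
    ext f
    constructor
    · rintro ⟨l, hl, hf, hf0, hfl⟩
      obtain ⟨u, hu, rfl⟩ := (memDom_iff ν).1 hf
      refine ⟨⟨u, hu⟩, ⟨?_, l, hl, fun g => ?_⟩, rfl⟩
      · intro h
        apply hf0
        rw [show u = 0 from congrArg Subtype.val h, map_zero]
      · have := hfl (primitive g) ((memDom_iff ν).2 ⟨g, g.2, rfl⟩)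
        rw [energy_primitive, ← inner_embed] at this
        exact this
    · rintro ⟨u, ⟨hu0, l, hl, hul⟩, rfl⟩
      refine ⟨l, hl, (memDom_iff ν).2 ⟨u, u.2, rfl⟩, fun h => hu0 (hΦ (by rw [map_zero]; exact h)),
        fun g hg => ?_⟩
      obtain ⟨v, hv, rfl⟩ := (memDom_iff ν).1 hg
      change energy (primitive u) (primitive v) = l * innerL2 ν (primitive u) (primitive v)
      rw [energy_primitive, ← inner_embed]
      exact hul ⟨v, hv⟩
  rw [eigenvalueCount, hset, Submodule.span_image,
    ← (Submodule.equivMapOfInjective Φ hΦ _).rank_eq]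

/-! ### The upper bound for the counting function -/

theorem sum_intervalIntegral_partition {n : ℕ} (c : Fin (n + 1) → ℝ) {f : ℝ → ℝ} {μ : Measure ℝ}
    (h : ∀ i j, IntervalIntegrable f μ (c i) (c j)) :
    ∑ k : Fin n, ∫ t in c k.castSucc..c k.succ, f t ∂μ = ∫ t in c 0..c (Fin.last n), f t ∂μ := by
  induction n with
  | zero => simp
  | succ n ih =>
    rw [Fin.sum_univ_castSucc]
    have := ih (fun i => c i.castSucc) fun i j => h _ _
    simp only [Fin.castSucc_zero] at this
    simp only [← Fin.succ_castSucc] at this ⊢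
    rw [← Fin.succ_last]
    simp only [Fin.succ_castSucc] at this ⊢
    rw [this]
    exact intervalIntegral.integral_add_adjacent_intervals (h _ _) (h _ _)

theorem L2I.intervalIntegrable_sq (u : L2I) {p q : ℝ} (hp : p ∈ Icc (0 : ℝ) 1)
    (hq : q ∈ Icc (0 : ℝ) 1) : IntervalIntegrable (fun t => u t ^ 2) volume p q := by
  have h1 : IntegrableOn (fun t => u t ^ 2) (Icc 0 1) := (Lp.memLp u).integrable_sq
  exact (h1.mono_set (uIcc_subset_Icc hp hq)).intervalIntegrable

theorem sq_intervalIntegral_le {g : ℝ → ℝ} {a b : ℝ} (hab : a ≤ b)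
    (h1 : IntervalIntegrable g volume a b)
    (h2 : IntervalIntegrable (fun t => g t ^ 2) volume a b) :
    (∫ t in a..b, g t) ^ 2 ≤ (b - a) * ∫ t in a..b, g t ^ 2 := by
  rcases hab.eq_or_lt with rfl | hlt
  · simp
  set A := ∫ t in a..b, g t with hA
  -- The mean of `g`; Cauchy–Schwarz is then nonnegativity of the variance.
  set s := A / (b - a) with hs
  have hba : 0 < b - a := by linarith
  have h3 : 0 ≤ ∫ t in a..b, (g t - s) ^ 2 :=
    intervalIntegral.integral_nonneg hab fun t _ => sq_nonneg _
  have h4 : ∫ t in a..b, (g t - s) ^ 2 = (∫ t in a..b, g t ^ 2) - 2 * s * A + s ^ 2 * (b - a) := by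
    have e : ∀ t, (g t - s) ^ 2 = (g t ^ 2 - 2 * s * g t) + s ^ 2 := fun t => by ring
    simp only [e]
    rw [intervalIntegral.integral_add (h2.sub (h1.const_mul _)) intervalIntegrable_const,
      intervalIntegral.integral_sub h2 (h1.const_mul _), intervalIntegral.integral_const_mul,
      intervalIntegral.integral_const, smul_eq_mul]
    ring
  rw [h4] at h3
  have h5 : s * (b - a) = A := by rw [hs]; field_simp
  nlinarith

theorem L2I.norm_sq (u : L2I) : ‖u‖ ^ 2 = ∫ t in (0 : ℝ)..1, u t ^ 2 := by
  rw [← real_inner_self_eq_norm_sq, L2.inner_def, intervalIntegral.integral_of_le zero_le_one,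
    integral_Icc_eq_integral_Ioc]
  refine integral_congr_ae (Eventually.of_forall fun t => ?_)
  change u t * u t = u t ^ 2
  ring

theorem continuousOn_primitive (u : L2I) :
    ContinuousOn (fun y : ℝ => ∫ t in (0 : ℝ)..y, u t) (Icc 0 1) := by
  have h := intervalIntegral.continuousOn_primitive_interval'
    (u.intervalIntegrable (p := 0) (q := 1) (by simp) (by simp)) (a := 0) (by simp)
  rwa [uIcc_of_le zero_le_one] at h

theorem integrableOn_primitive_sq (u : L2I) :
    IntegrableOn (fun y : ℝ => (∫ t in (0 : ℝ)..y, u t) ^ 2) (Icc 0 1) ν :=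
  ((continuousOn_primitive u).pow 2).integrableOn_compact isCompact_Icc

theorem norm_embed_sq (u : L2I) :
    ‖embed ν u‖ ^ 2 = ∫ y in Icc (0 : ℝ) 1, (∫ t in (0 : ℝ)..y, u t) ^ 2 ∂ν := by
  rw [← real_inner_self_eq_norm_sq, inner_embed, innerL2,
    ← integral_subtype_comap measurableSet_Icc]
  refine integral_congr_ae (Eventually.of_forall fun x => ?_)
  simp only [primitive_apply, sq]

variable {ν}

theorem setIntegral_primitive_sq_le {u : L2I} {a b : ℝ} (ha : 0 ≤ a) (hab : a ≤ b) (hb : b ≤ 1)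
    (h0 : ∫ t in (0 : ℝ)..a, u t = 0) :
    ∫ y in a..b, (∫ t in (0 : ℝ)..y, u t) ^ 2 ∂ν ≤
      ν.real (Ioc a b) * (b - a) * ∫ t in a..b, u t ^ 2 := by
  rw [intervalIntegral.integral_of_le hab]
  have haI : a ∈ Icc (0 : ℝ) 1 := ⟨ha, hab.trans hb⟩
  have hbI : b ∈ Icc (0 : ℝ) 1 := ⟨ha.trans hab, hb⟩
  have hpt : ∀ y ∈ Ioc a b, (∫ t in (0 : ℝ)..y, u t) ^ 2 ≤ (b - a) * ∫ t in a..b, u t ^ 2 := by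
    intro y hy
    have hyI : y ∈ Icc (0 : ℝ) 1 := ⟨ha.trans hy.1.le, hy.2.trans hb⟩
    have e : ∫ t in (0 : ℝ)..y, u t = ∫ t in a..y, u t := by
      rw [← intervalIntegral.integral_add_adjacent_intervals
        (u.intervalIntegrable (by simp) haI) (u.intervalIntegrable haI hyI), h0, zero_add]
    rw [e]
    refine (sq_intervalIntegral_le hy.1.le (u.intervalIntegrable haI hyI)
      (u.intervalIntegrable_sq haI hyI)).trans ?_
    refine mul_le_mul (by linarith [hy.2]) ?_
      (intervalIntegral.integral_nonneg hy.1.le fun t _ => sq_nonneg _) (by linarith)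
    rw [← intervalIntegral.integral_add_adjacent_intervals
      (u.intervalIntegrable_sq haI hyI) (u.intervalIntegrable_sq hyI hbI)]
    have := intervalIntegral.integral_nonneg (μ := volume) hy.2 fun t _ => sq_nonneg (u t)
    linarith
  refine (setIntegral_mono_on ((integrableOn_primitive_sq ν u).mono_set
    (Ioc_subset_Icc_self.trans (Icc_subset_Icc ha hb))) (integrable_const _)
    measurableSet_Ioc hpt).trans (le_of_eq ?_)
  rw [setIntegral_const, smul_eq_mul]; ring

/-- A function vanishing at the left end of a cell has square at most length times energy on that
cell, so its `ν`-mass there is at most `ν(C) Λ(C)` times the energy. Strictness comes from a cell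
with positive energy. -/
theorem norm_embed_sq_lt {n : ℕ} {c : Fin (n + 1) → ℝ} (hc : IsPartition ν c) {x : ℝ}
    (hcx : ∀ k : Fin n, ν.real (Ioc (c k.castSucc) (c k.succ)) *
      volume.real (Ioc (c k.castSucc) (c k.succ)) < 1 / x) {u : L2I} (hu : u ≠ 0)
    (hz : ∀ k : Fin n, ∫ t in (0 : ℝ)..c k.castSucc, u t = 0) :
    ‖embed ν u‖ ^ 2 < 1 / x * ‖u‖ ^ 2 := by
  obtain ⟨hmono, h0, h1, hatom⟩ := hc
  have hI : ∀ i, c i ∈ Icc (0 : ℝ) 1 := fun i =>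
    ⟨h0 ▸ hmono.monotone (Fin.zero_le i), h1 ▸ hmono.monotone (Fin.le_last i)⟩
  have hν0 : ν {(0 : ℝ)} = 0 := by rw [← h0]; exact hatom 0
  have e1 : ‖embed ν u‖ ^ 2 =
      ∑ k : Fin n, ∫ y in c k.castSucc..c k.succ, (∫ t in (0 : ℝ)..y, u t) ^ 2 ∂ν := by
    rw [sum_intervalIntegral_partition c fun i j =>
      ((integrableOn_primitive_sq ν u).mono_set
        (uIcc_subset_Icc (hI i) (hI j))).intervalIntegrable, h0, h1, norm_embed_sq,
      intervalIntegral.integral_of_le zero_le_one]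
    exact integral_Icc_eq_integral_Ioc' hν0
  have e2 : ‖u‖ ^ 2 = ∑ k : Fin n, ∫ t in c k.castSucc..c k.succ, u t ^ 2 := by
    rw [sum_intervalIntegral_partition c fun i j => u.intervalIntegrable_sq (hI i) (hI j), h0, h1,
      L2I.norm_sq]
  have hlt : ∀ k : Fin n, c k.castSucc < c k.succ := fun k => hmono Fin.castSucc_lt_succ
  have hnn : ∀ k : Fin n, 0 ≤ ∫ t in c k.castSucc..c k.succ, u t ^ 2 := fun k =>
    intervalIntegral.integral_nonneg (hlt k).le fun t _ => sq_nonneg _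
  have hJ : ∀ k : Fin n, ν.real (Ioc (c k.castSucc) (c k.succ)) *
      (c k.succ - c k.castSucc) < 1 / x := fun k => by
    have := hcx k
    rwa [Real.volume_real_Ioc_of_le (hlt k).le] at this
  obtain ⟨k₀, hk₀⟩ : ∃ k : Fin n, 0 < ∫ t in c k.castSucc..c k.succ, u t ^ 2 := by
    by_contra! hle
    have : ‖u‖ ^ 2 ≤ 0 := by
      rw [e2]
      exact Finset.sum_nonpos fun k _ => hle k
    have hpos := norm_pos_iff.2 hu
    nlinarith
  rw [e1]
  refine lt_of_le_of_lt (Finset.sum_le_sum fun k _ => setIntegral_primitive_sq_le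
    (hI _).1 (hlt k).le (hI _).2 (hz k)) ?_
  rw [e2, Finset.mul_sum]
  exact Finset.sum_lt_sum (fun k _ => mul_le_mul_of_nonneg_right (hJ k).le (hnn k))
    ⟨k₀, Finset.mem_univ _, mul_lt_mul_of_pos_right (hJ k₀) hk₀⟩

theorem eigenvalueCount_le_partitionCount {x : ℝ} (hx : 0 < x) :
    eigenvalueCount ν x ≤ partitionCount ν x := by
  refine le_sInf ?_
  rintro _ ⟨n, c, rfl, hc, hcx⟩
  rw [eigenvalueCount_eq]
  set V := Submodule.span ℝ (formEigenvectors (embedDom ν) x)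
  have hI : ∀ i, c i ∈ Icc (0 : ℝ) 1 := fun i =>
    ⟨hc.2.1 ▸ hc.1.monotone (Fin.zero_le i), hc.2.2.1 ▸ hc.1.monotone (Fin.le_last i)⟩
  -- Evaluation at the `n` left ends only. A vector in the kernel would satisfy both `‖u‖² ≤ x ‖b
  -- u‖²` and the strict reverse inequality.
  let E : V →ₗ[ℝ] (Fin n → ℝ) := LinearMap.pi fun k =>
    (ContinuousMap.evalCLM ℝ (⟨c k.castSucc, hI _⟩ : I) ∘L primitive ∘L
      (formDomain ν).subtypeL : formDomain ν →ₗ[ℝ] ℝ) ∘ₗ V.subtype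
  have hE : Function.Injective E := by
    rw [injective_iff_map_eq_zero]
    intro v hv
    by_contra hv0
    have hu0 : ((v : formDomain ν) : L2I) ≠ 0 := by
      intro h
      exact hv0 (Subtype.ext (Subtype.ext h))
    have h1 := norm_embed_sq_lt hc hcx hu0 fun k => congrFun hv k
    have h2 := norm_sq_le_of_mem_span_formEigenvectors v.2
    have h3 : ‖((v : formDomain ν) : L2I)‖ ^ 2 ≤ x * ‖embed ν ((v : formDomain ν) : L2I)‖ ^ 2 := h2
    rw [one_div, inv_mul_eq_div, lt_div_iff₀ hx] at h1
    linarith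
  have hr := LinearMap.rank_le_of_injective E hE
  rw [rank_fin_fun] at hr
  exact Cardinal.toENat_le_natCast.2 hr

end Domain

section

/-! ### Functions that are affine off the support -/

/-- Collinearity of any three points of the graph is free of existential quantifiers and closed
under pointwise limits; completeness of the form domain relies on it. -/
theorem exists_affine_iff {C : Set I} {f : I → ℝ} :
    (∃ a b : ℝ, ∀ y ∈ C, f y = a * y + b) ↔ ∀ p ∈ C, ∀ q ∈ C, ∀ r ∈ C,
      f p * ((q : ℝ) - r) + f q * ((r : ℝ) - p) + f r * ((p : ℝ) - q) = 0 := by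
  constructor
  · rintro ⟨a, b, h⟩ p hp q hq r hr
    rw [h p hp, h q hq, h r hr]; ring
  · intro h
    by_cases hC : ∃ p ∈ C, ∃ q ∈ C, p ≠ q
    · obtain ⟨p, hp, q, hq, hpq⟩ := hC
      have hd : (q : ℝ) - p ≠ 0 := sub_ne_zero.2 fun e => hpq (Subtype.ext e.symm)
      refine ⟨(f q - f p) / (q - p), f p - (f q - f p) / (q - p) * p, fun y hy => ?_⟩
      have h1 := h p hp q hq y hy
      field_simp
      linarith
    · push Not at hC
      rcases C.eq_empty_or_nonempty with rfl | ⟨p, hp⟩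
      · exact ⟨0, 0, fun y hy => absurd hy (notMem_empty y)⟩
      · exact ⟨0, f p, fun y hy => by rw [hC y hy p hp]; ring⟩

theorem continuous_primitive_apply (x : I) : Continuous fun u : L2I => primitive u x :=
  (continuous_eval_const x).comp primitive.continuous

theorem isClosed_formDomain (ν : Measure ℝ) : IsClosed (formDomain ν : Set L2I) := by
  have e : (formDomain ν : Set L2I) = {u | primitive u 1 = 0} ∩
      ⋂ (x : I) (_ : (x : ℝ) ∉ ν.support)
        (p ∈ connectedComponentIn {z : I | (z : ℝ) ∉ ν.support} x)
        (q ∈ connectedComponentIn {z : I | (z : ℝ) ∉ ν.support} x)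
        (r ∈ connectedComponentIn {z : I | (z : ℝ) ∉ ν.support} x),
        {u | primitive u p * ((q : ℝ) - r) + primitive u q * ((r : ℝ) - p) +
          primitive u r * ((p : ℝ) - q) = 0} := by
    ext u
    simp only [mem_inter_iff, mem_iInter, mem_ofPred_eq]
    refine and_congr Iff.rfl (forall_congr' fun x => forall_congr' fun _ => ?_)
    exact exists_affine_iff (f := primitive u)
  rw [e]
  refine (isClosed_eq (continuous_primitive_apply 1) continuous_const).inter ?_
  refine isClosed_iInter fun x => isClosed_iInter fun _ => isClosed_biInter fun p _ =>
    isClosed_biInter fun q _ => isClosed_biInter fun r _ => isClosed_eq ?_ continuous_const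
  exact (((continuous_primitive_apply p).mul continuous_const).add
    ((continuous_primitive_apply q).mul continuous_const)).add
    ((continuous_primitive_apply r).mul continuous_const)

instance (ν : Measure ℝ) : CompleteSpace (formDomain ν) :=
  (isClosed_formDomain ν).completeSpace_coe

/-- The weak derivatives of the functions in `H¹₀` that vanish on the support of `ν`. -/
def vanishing (ν : Measure ℝ) : Submodule ℝ L2I where
  carrier := {u | primitive u 1 = 0 ∧ ∀ s : I, (s : ℝ) ∈ ν.support → primitive u s = 0}
  zero_mem' := ⟨by simp, fun s _ => by simp⟩
  add_mem' := fun {u v} hu hv =>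
    ⟨by rw [map_add, ContinuousMap.add_apply, hu.1, hv.1, add_zero], fun s hs => by
      rw [map_add, ContinuousMap.add_apply, hu.2 s hs, hv.2 s hs, add_zero]⟩
  smul_mem' := fun c u hu =>
    ⟨by rw [map_smul, ContinuousMap.smul_apply, hu.1, smul_zero], fun s hs => by
      rw [map_smul, ContinuousMap.smul_apply, hu.2 s hs, smul_zero]⟩

theorem isClosed_vanishing (ν : Measure ℝ) : IsClosed (vanishing ν : Set L2I) := by
  have e : (vanishing ν : Set L2I) = {u | primitive u 1 = 0} ∩
      ⋂ (s : I) (_ : (s : ℝ) ∈ ν.support), {u | primitive u s = 0} := by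
    ext u
    simp only [mem_inter_iff, mem_iInter, mem_ofPred_eq]
    exact Iff.rfl
  rw [e]
  exact (isClosed_eq (continuous_primitive_apply 1) continuous_const).inter
    (isClosed_iInter fun s => isClosed_iInter fun _ =>
      isClosed_eq (continuous_primitive_apply s) continuous_const)

instance (ν : Measure ℝ) : CompleteSpace (vanishing ν) :=
  (isClosed_vanishing ν).completeSpace_coe

theorem primitive_step {p q : ℝ} (y : I) :
    primitive (step p q) y = max (min (y : ℝ) q - max 0 p) 0 := by
  rw [primitive_eq_inner, inner_step_step le_rfl y.2.2]

/-- Orthogonality is tested against the tent function on `[p, r]` with peak at `q`, which vanishes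
on the support because `[p, r]` misses it. -/
theorem three_point_of_mem_orthogonal {ν : Measure ℝ} {u : L2I} (hu : u ∈ (vanishing ν)ᗮ)
    {p q r : I} (hpq : p ≤ q) (hqr : q ≤ r) (hs : ∀ s : I, p ≤ s → s ≤ r → (s : ℝ) ∉ ν.support) :
    primitive u p * ((q : ℝ) - r) + primitive u q * ((r : ℝ) - p) +
      primitive u r * ((p : ℝ) - q) = 0 := by
  have hpq' : (p : ℝ) ≤ q := hpq
  have hqr' : (q : ℝ) ≤ r := hqr
  have hp0 : (0 : ℝ) ≤ p := p.2.1
  have hr1 : (r : ℝ) ≤ 1 := r.2.2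
  have hprim : ∀ y : I, primitive (((r : ℝ) - q) • step p q - ((q : ℝ) - p) • step q r) y =
      (r - q) * max (min (y : ℝ) q - p) 0 - (q - p) * max (min (y : ℝ) r - q) 0 := by
    intro y
    rw [map_sub, map_smul, map_smul, ContinuousMap.sub_apply, ContinuousMap.smul_apply,
      ContinuousMap.smul_apply, primitive_step, primitive_step, max_eq_right hp0,
      max_eq_right (hp0.trans hpq'), smul_eq_mul, smul_eq_mul]
  have hright : ∀ y : I, r ≤ y →
      primitive (((r : ℝ) - q) • step p q - ((q : ℝ) - p) • step q r) y = 0 := by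
    intro y hy
    have hy' : (r : ℝ) ≤ y := hy
    rw [hprim, min_eq_right (hqr'.trans hy'), min_eq_right hy', max_eq_left (by linarith),
      max_eq_left (by linarith)]
    ring
  have hmem : ((r : ℝ) - q) • step p q - ((q : ℝ) - p) • step q r ∈ vanishing ν := by
    refine ⟨hright 1 r.2.2, fun s hsupp => ?_⟩
    rcases le_total r s with h | h
    · exact hright s h
    · have h2 : s ≤ p := by
        by_contra hn
        exact hs s (le_of_not_ge hn) h hsupp
      have h2' : (s : ℝ) ≤ p := h2
      rw [hprim, min_eq_left (h2'.trans hpq'), min_eq_left (h2'.trans (hpq'.trans hqr')),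
        max_eq_right (by linarith), max_eq_right (by linarith)]
      ring
  have h0 := Submodule.inner_right_of_mem_orthogonal hmem hu
  rw [inner_sub_left, real_inner_smul_left, real_inner_smul_left, ← primitive_sub u hpq,
    ← primitive_sub u hqr] at h0
  linarith

theorem mem_formDomain_of_mem_orthogonal {ν : Measure ℝ} {u : L2I} (h1 : primitive u 1 = 0)
    (hu : u ∈ (vanishing ν)ᗮ) : u ∈ formDomain ν := by
  refine ⟨h1, fun x _ => exists_affine_iff.2 ?_⟩
  have hord : (connectedComponentIn {z : I | (z : ℝ) ∉ ν.support} x).OrdConnected :=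
    isPreconnected_connectedComponentIn.ordConnected
  have key : ∀ p ∈ connectedComponentIn {z : I | (z : ℝ) ∉ ν.support} x, ∀ q : I,
      ∀ r ∈ connectedComponentIn {z : I | (z : ℝ) ∉ ν.support} x, p ≤ q → q ≤ r →
      primitive u p * ((q : ℝ) - r) + primitive u q * ((r : ℝ) - p) +
        primitive u r * ((p : ℝ) - q) = 0 := fun p hp q r hr hpq hqr =>
    three_point_of_mem_orthogonal hu hpq hqr fun s hps hsr =>
      connectedComponentIn_subset {z : I | (z : ℝ) ∉ ν.support} x (hord.out hp hr ⟨hps, hsr⟩)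
  intro p hp q hq r hr
  rcases le_total p q with h | h <;> rcases le_total q r with h' | h' <;>
    rcases le_total p r with h'' | h''
  · linarith [key p hp q r hr h h']
  · linarith [key p hp q r hr h h']
  · linarith [key p hp r q hq h'' h']
  · linarith [key r hr p q hq h'' h]
  · linarith [key q hq p r hr h h'']
  · linarith [key q hq r p hp h' h'']
  · linarith [key r hr q p hp h' h]
  · linarith [key r hr q p hp h' h]

theorem embed_eq_zero_of_mem_vanishing {ν : Measure ℝ} [IsFiniteMeasure ν] {u : L2I}
    (hu : u ∈ vanishing ν) : embed ν u = 0 := by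
  rw [← norm_eq_zero, ← sq_eq_zero_iff, norm_embed_sq]
  have h : ∀ᵐ y ∂ν, y ∈ ν.support := Measure.support_mem_ae
  refine integral_eq_zero_of_ae ?_
  filter_upwards [ae_restrict_mem measurableSet_Icc, ae_restrict_of_ae h] with y hy hs
  have := hu.2 ⟨y, hy⟩ hs
  rw [primitive_apply] at this
  rw [this]
  simp

/-! ### Trapezoidal test functions -/

/-- The weak derivative of the trapezoidal function that vanishes off `[a, b]` and is `1` on
`[a + h, b - h]`. -/
def trapezoid (a b h : ℝ) : L2I := h⁻¹ • (step a (a + h) - step (b - h) b)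

section Trapezoid

variable {a b h : ℝ}

theorem primitive_trapezoid (ha : 0 ≤ a) (hh : 0 < h) (hab : a + h ≤ b - h) (y : I) :
    primitive (trapezoid a b h) y =
      h⁻¹ * (max (min (y : ℝ) (a + h) - a) 0 - max (min (y : ℝ) b - (b - h)) 0) := by
  rw [trapezoid, map_smul, map_sub, ContinuousMap.smul_apply, ContinuousMap.sub_apply,
    primitive_step, primitive_step, max_eq_right ha, max_eq_right (by linarith : 0 ≤ b - h),
    smul_eq_mul]

theorem primitive_trapezoid_of_le (ha : 0 ≤ a) (hh : 0 < h) (hab : a + h ≤ b - h) {y : I}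
    (hy : (y : ℝ) ≤ a) : primitive (trapezoid a b h) y = 0 := by
  rw [primitive_trapezoid ha hh hab, min_eq_left (by linarith), min_eq_left (by linarith),
    max_eq_right (by linarith), max_eq_right (by linarith)]
  ring

theorem primitive_trapezoid_of_ge (ha : 0 ≤ a) (hh : 0 < h) (hab : a + h ≤ b - h) {y : I}
    (hy : b ≤ y) : primitive (trapezoid a b h) y = 0 := by
  rw [primitive_trapezoid ha hh hab, min_eq_right (by linarith), min_eq_right (by linarith),
    max_eq_left (by linarith), max_eq_left (by linarith)]
  ring

theorem primitive_trapezoid_of_mem (ha : 0 ≤ a) (hh : 0 < h) (hab : a + h ≤ b - h) {y : I}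
    (hy : (y : ℝ) ∈ Icc (a + h) (b - h)) : primitive (trapezoid a b h) y = 1 := by
  rw [primitive_trapezoid ha hh hab, min_eq_right hy.1, min_eq_left (by linarith [hy.2]),
    max_eq_left (by linarith), max_eq_right (by linarith [hy.2])]
  field_simp
  ring

/-- Two flanks of length `h` with slope `±1/h`. -/
theorem norm_trapezoid_sq (ha : 0 ≤ a) (hh : 0 < h) (hab : a + h ≤ b - h) (hb : b ≤ 1) :
    ‖trapezoid a b h‖ ^ 2 = 2 / h := by
  rw [← real_inner_self_eq_norm_sq, trapezoid, real_inner_smul_left, real_inner_smul_right,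
    inner_sub_left, inner_sub_right, inner_sub_right, inner_step_step ha (by linarith),
    inner_step_step ha (by linarith), inner_step_step (by linarith) hb,
    inner_step_step (by linarith) hb, min_self, max_self, min_self, max_self,
    min_eq_left (by linarith : a + h ≤ b), max_eq_right (by linarith : a ≤ b - h),
    min_eq_right (by linarith : a + h ≤ b), max_eq_left (by linarith : a ≤ b - h),
    max_eq_right (by linarith : a + h - (b - h) ≤ 0), max_eq_left (by linarith),
    max_eq_left (by linarith)]
  field_simp
  ring

theorem inner_trapezoid_eq_zero {a' b' h' : ℝ} (ha : 0 ≤ a) (hh : 0 < h) (hab : a + h ≤ b - h)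
    (hb : b ≤ 1) (hh' : 0 < h') (hab' : a' + h' ≤ b' - h') (hba : b ≤ a') :
    inner ℝ (trapezoid a b h) (trapezoid a' b' h') = 0 := by
  have e : ∀ p q r s : ℝ, 0 ≤ p → q ≤ b → a' ≤ r → inner ℝ (step p q) (step r s) = 0 := by
    intro p q r s hp hq hr
    rw [inner_step_step hp (hq.trans hb), max_eq_right]
    have := min_le_left q s
    have := le_max_right p r
    linarith
  rw [trapezoid, trapezoid, real_inner_smul_left, real_inner_smul_right, inner_sub_left,
    inner_sub_right, inner_sub_right, e _ _ _ _ ha (by linarith) le_rfl,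
    e _ _ _ _ ha (by linarith) (by linarith), e _ _ _ _ (by linarith) le_rfl le_rfl,
    e _ _ _ _ (by linarith) le_rfl (by linarith)]
  simp

variable (ν : Measure ℝ) [IsFiniteMeasure ν]

theorem inner_embed_trapezoid_eq_zero {a' b' h' : ℝ} (ha : 0 ≤ a) (hh : 0 < h)
    (hab : a + h ≤ b - h) (ha' : 0 ≤ a') (hh' : 0 < h') (hab' : a' + h' ≤ b' - h')
    (hba : b ≤ a') :
    inner ℝ (embed ν (trapezoid a b h)) (embed ν (trapezoid a' b' h')) = 0 := by
  rw [inner_embed, innerL2]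
  refine integral_eq_zero_of_ae (Eventually.of_forall fun x => ?_)
  rcases le_total (x : ℝ) b with hx | hx
  · simp only [primitive_trapezoid_of_le ha' hh' hab' (hx.trans hba), mul_zero, Pi.zero_apply]
  · simp only [primitive_trapezoid_of_ge ha hh hab hx, zero_mul, Pi.zero_apply]

theorem measureReal_le_norm_embed_trapezoid (ha : 0 ≤ a) (hh : 0 < h) (hab : a + h ≤ b - h)
    (hb : b ≤ 1) : ν.real (Icc (a + h) (b - h)) ≤ ‖embed ν (trapezoid a b h)‖ ^ 2 := by
  rw [norm_embed_sq]
  have hsub : Icc (a + h) (b - h) ⊆ Icc (0 : ℝ) 1 := Icc_subset_Icc (by linarith) (by linarith)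
  refine le_trans (le_of_eq ?_) (setIntegral_mono_set (integrableOn_primitive_sq ν _)
    (Eventually.of_forall fun y => sq_nonneg _) hsub.eventuallyLE)
  have e : ∫ y in Icc (a + h) (b - h), (∫ t in (0 : ℝ)..y, trapezoid a b h t) ^ 2 ∂ν =
      ∫ y in Icc (a + h) (b - h), (1 : ℝ) ∂ν := by
    refine setIntegral_congr_fun measurableSet_Icc fun y hy => ?_
    have := primitive_trapezoid_of_mem ha hh hab (y := ⟨y, hsub hy⟩) hy
    rw [primitive_apply] at this
    simp only [this, one_pow]
  rw [e]
  simp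

end Trapezoid

/-! ### The lower bound for the counting function -/

theorem norm_sq_sum_smul {ι E : Type*} [Fintype ι] [NormedAddCommGroup E] [InnerProductSpace ℝ E]
    {v : ι → E} (hv : Pairwise fun i j => inner ℝ (v i) (v j) = 0) (c : ι → ℝ) :
    ‖∑ i, c i • v i‖ ^ 2 = ∑ i, c i ^ 2 * ‖v i‖ ^ 2 := by
  classical
  rw [← real_inner_self_eq_norm_sq, sum_inner]
  refine Finset.sum_congr rfl fun i _ => ?_
  rw [inner_sum, Finset.sum_eq_single i]
  · rw [real_inner_smul_left, real_inner_smul_right, real_inner_self_eq_norm_sq]; ring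
  · intro j _ hj
    rw [real_inner_smul_left, real_inner_smul_right, hv hj.symm]; ring
  · exact fun h => absurd (Finset.mem_univ i) h

variable {ν : Measure ℝ} [IsFiniteMeasure ν]

/-- The test functions need not be affine off the support. Projecting onto the complement of
`vanishing ν` makes them so, leaves their image in `L²(ν)` unchanged and does not increase the
energy, so the variational principle applies to the span of the projections. -/
theorem card_le_eigenvalueCount {ι : Type*} [Fintype ι] {u : ι → L2I} {x : ℝ} (hx : 0 < x)
    (h1 : ∀ i, primitive (u i) 1 = 0)
    (horth : Pairwise fun i j => inner ℝ (u i) (u j) = 0)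
    (horth' : Pairwise fun i j => inner ℝ (embed ν (u i)) (embed ν (u j)) = 0)
    (hne : ∀ i, embed ν (u i) ≠ 0) (hle : ∀ i, ‖u i‖ ^ 2 ≤ x * ‖embed ν (u i)‖ ^ 2) :
    (Fintype.card ι : ℕ∞) ≤ eigenvalueCount ν x := by
  let Q : L2I →L[ℝ] L2I := (vanishing ν)ᗮ.starProjection
  have hQ : ∀ v, v - Q v ∈ vanishing ν := fun v => by
    have := Submodule.sub_starProjection_mem_orthogonal (K := (vanishing ν)ᗮ) v
    rwa [Submodule.orthogonal_orthogonal] at this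
  have hQe : ∀ v, embed ν (Q v) = embed ν v := fun v => by
    have := embed_eq_zero_of_mem_vanishing (hQ v)
    rw [map_sub, sub_eq_zero] at this
    exact this.symm
  have hQd : ∀ i, Q (u i) ∈ formDomain ν := fun i => by
    refine mem_formDomain_of_mem_orthogonal ?_ (Submodule.starProjection_apply_mem _ _)
    have := (hQ (u i)).1
    rw [map_sub, ContinuousMap.sub_apply, h1 i, zero_sub, neg_eq_zero] at this
    exact this
  let w : ι → formDomain ν := fun i => ⟨Q (u i), hQd i⟩
  have hw : ∀ i, embedDom ν (w i) = embed ν (u i) := fun i => hQe (u i)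
  have hli : LinearIndependent ℝ w := by
    refine LinearIndependent.of_comp (embedDom ν).toLinearMap ?_
    refine linearIndependent_of_ne_zero_of_inner_eq_zero (𝕜 := ℝ) (fun i => ?_) fun i j hij => ?_
    · change embedDom ν (w i) ≠ 0
      rw [hw]; exact hne i
    · change inner ℝ (embedDom ν (w i)) (embedDom ν (w j)) = 0
      rw [hw, hw]; exact horth' hij
  have hfin : FiniteDimensional ℝ (Submodule.span ℝ (Set.range w)) :=
    FiniteDimensional.span_of_finite ℝ (Set.finite_range w)
  have hcomp : IsCompactOperator (embedDom ν) :=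
    (isCompactOperator_primitive.clm_comp
      (ContinuousMap.toLp 2 (ν.comap (Subtype.val : I → ℝ)) ℝ)).comp_clm (formDomain ν).subtypeL
  have hW : ∀ v ∈ Submodule.span ℝ (Set.range w), ‖v‖ ^ 2 ≤ x * ‖embedDom ν v‖ ^ 2 := by
    intro v hv
    obtain ⟨c, rfl⟩ := (Submodule.mem_span_range_iff_exists_fun ℝ).1 hv
    have e1 : ((∑ i, c i • w i : formDomain ν) : L2I) = Q (∑ i, c i • u i) := by
      rw [map_sum, Submodule.coe_sum]
      exact Finset.sum_congr rfl fun i _ => by rw [Submodule.coe_smul, map_smul]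
    have e2 : embedDom ν (∑ i, c i • w i) = ∑ i, c i • embed ν (u i) := by
      rw [map_sum]
      exact Finset.sum_congr rfl fun i _ => by rw [map_smul, hw]
    have h3 : ‖(∑ i, c i • w i : formDomain ν)‖ ≤ ‖∑ i, c i • u i‖ := by
      rw [Submodule.coe_norm, e1]
      exact Submodule.norm_starProjection_apply_le _ _
    calc ‖(∑ i, c i • w i : formDomain ν)‖ ^ 2 ≤ ‖∑ i, c i • u i‖ ^ 2 := by gcongr
      _ = ∑ i, c i ^ 2 * ‖u i‖ ^ 2 := norm_sq_sum_smul horth c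
      _ ≤ ∑ i, c i ^ 2 * (x * ‖embed ν (u i)‖ ^ 2) :=
          Finset.sum_le_sum fun i _ => mul_le_mul_of_nonneg_left (hle i) (sq_nonneg _)
      _ = x * ‖embedDom ν (∑ i, c i • w i)‖ ^ 2 := by
          rw [e2, norm_sq_sum_smul horth' c, Finset.mul_sum]
          exact Finset.sum_congr rfl fun i _ => by ring
  have hmain := finrank_le_rank_formEigenvectors hcomp hx _ hW
  rw [finrank_span_eq_card hli] at hmain
  rw [eigenvalueCount_eq]
  exact Cardinal.natCast_le_toENat.2 hmain

theorem reducedCount_le_eigenvalueCount {m x : ℝ} (hm : 1 < m) (hx : 0 < x) :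
    reducedCount ν m x ≤ eigenvalueCount ν x := by
  refine sSup_le ?_
  rintro _ ⟨P, rfl, ⟨hP, hdisj⟩, hPx⟩
  have hm0 : 0 < m := by linarith
  -- This flank width makes the plateau equal to `centered m p.1 p.2`.
  set h : ℝ × ℝ → ℝ := fun p => (p.2 - p.1) * (m - 1) / (2 * m) with hh
  have hpos : ∀ p ∈ P, 0 < h p := fun p hp => by
    have := (hP p hp).2.1
    exact div_pos (mul_pos (by linarith) (by linarith)) (by linarith)
  have hl : ∀ p : ℝ × ℝ, p.1 + h p = (p.1 + p.2) / 2 - (p.2 - p.1) / (2 * m) := fun p => by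
    simp only [hh]; field_simp; ring
  have hr : ∀ p : ℝ × ℝ, p.2 - h p = (p.1 + p.2) / 2 + (p.2 - p.1) / (2 * m) := fun p => by
    simp only [hh]; field_simp; ring
  have hc : ∀ p : ℝ × ℝ, centered m p.1 p.2 = Icc (p.1 + h p) (p.2 - h p) := fun p => by
    rw [hl, hr]; rfl
  have hlen : ∀ p : ℝ × ℝ, p.2 - h p - (p.1 + h p) = (p.2 - p.1) / m := fun p => by
    rw [hl, hr]; field_simp; ring
  have hle : ∀ p ∈ P, p.1 + h p ≤ p.2 - h p := fun p hp => by
    have h1 := hlen p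
    have h2 : 0 < (p.2 - p.1) / m := div_pos (by linarith [(hP p hp).2.1]) hm0
    linarith
  have hsep : ∀ p ∈ P, ∀ q ∈ P, p ≠ q → p.2 ≤ q.1 ∨ q.2 ≤ p.1 := by
    intro p hp q hq hpq
    have h1 : Disjoint (Ioc p.1 p.2) (Ioc q.1 q.2) := hdisj hp hq hpq
    rw [Ioc_disjoint_Ioc] at h1
    have := (hP p hp).2.1
    have := (hP q hq).2.1
    rcases le_total p.2 q.2 with h2 | h2 <;> rcases le_total p.1 q.1 with h3 | h3
    · rw [min_eq_left h2, max_eq_right h3] at h1; exact Or.inl h1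
    · rw [min_eq_left h2, max_eq_left h3] at h1; linarith
    · rw [min_eq_right h2, max_eq_right h3] at h1; linarith
    · rw [min_eq_right h2, max_eq_left h3] at h1; exact Or.inr h1
  let u : P → L2I := fun p => trapezoid p.1.1 p.1.2 (h p)
  -- The energy is `2/h = 4m / ((b-a)(m-1))` and the plateau has length `(b-a)/m`, so the threshold
  -- `4 / (x(m-1))` says exactly that the energy is at most `x` times the plateau mass.
  have hbound : ∀ p ∈ P, 2 / h p ≤ x * ν.real (Icc (p.1 + h p) (p.2 - h p)) := by
    intro p hp
    have h1 := hPx p hp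
    have hd : 0 < p.2 - p.1 := by linarith [(hP p hp).2.1]
    have hm1 : 0 < m - 1 := by linarith
    rw [hc, Real.volume_real_Icc_of_le (hle p hp), hlen] at h1
    rw [div_le_iff₀ (mul_pos hx hm1)] at h1
    rw [div_le_iff₀ (hpos p hp)]
    simp only [hh] at h1 ⊢
    calc (2 : ℝ) = 4 / 2 := by norm_num
      _ ≤ _ := by
        rw [div_le_iff₀ (by norm_num)]
        refine h1.trans (le_of_eq ?_)
        field_simp
  have hν1 : ∀ p : P, ν.real (Icc (p.1.1 + h p) (p.1.2 - h p)) ≤ ‖embed ν (u p)‖ ^ 2 := fun p =>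
    measureReal_le_norm_embed_trapezoid ν (hP p p.2).1 (hpos p p.2) (hle p p.2) (hP p p.2).2.2.1
  have hmain := card_le_eigenvalueCount (ν := ν) (u := u) hx ?_ ?_ ?_ ?_ ?_
  · simpa using hmain
  · intro p
    exact primitive_trapezoid_of_ge (hP p p.2).1 (hpos p p.2) (hle p p.2) (hP p p.2).2.2.1
  · intro p q hpq
    rcases hsep p p.2 q q.2 fun e => hpq (Subtype.ext e) with h1 | h1
    · exact inner_trapezoid_eq_zero (hP p p.2).1 (hpos p p.2) (hle p p.2) (hP p p.2).2.2.1
        (hpos q q.2) (hle q q.2) h1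
    · rw [real_inner_comm]
      exact inner_trapezoid_eq_zero (hP q q.2).1 (hpos q q.2) (hle q q.2) (hP q q.2).2.2.1
        (hpos p p.2) (hle p p.2) h1
  · intro p q hpq
    rcases hsep p p.2 q q.2 fun e => hpq (Subtype.ext e) with h1 | h1
    · exact inner_embed_trapezoid_eq_zero ν (hP p p.2).1 (hpos p p.2) (hle p p.2) (hP q q.2).1
        (hpos q q.2) (hle q q.2) h1
    · rw [real_inner_comm]
      exact inner_embed_trapezoid_eq_zero ν (hP q q.2).1 (hpos q q.2) (hle q q.2) (hP p p.2).1
        (hpos p p.2) (hle p p.2) h1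
  · intro p h0
    have h1 := hbound p p.2
    have h2 := hν1 p
    have h3 : 0 < 2 / h p := div_pos two_pos (hpos p p.2)
    rw [h0, norm_zero] at h2
    nlinarith
  · intro p
    rw [norm_trapezoid_sq (hP p p.2).1 (hpos p p.2) (hle p p.2) (hP p p.2).2.2.1]
    exact (hbound p p.2).trans (mul_le_mul_of_nonneg_left (hν1 p) hx.le)

end

end KreinFeller

end

/-! ### Closing the cycle of upper exponents, and the consequences -/

theorem theorem1p1 (ν : MeasureTheory.Measure ℝ) [MeasureTheory.IsFiniteMeasure ν]
    (hν : ν (Set.Ioo (0 : ℝ) 1)ᶜ = 0) (hν0 : ν ≠ 0) :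
    -- the fixed points of `βₙ` exist and are unique as soon as `2ⁿ` exceeds the total mass
    (∀ n : ℕ, 1 ≤ n → ν.real Set.univ < 2 ^ n → ∃! q : ℝ, KreinFeller.lqBeta ν n q = q) ∧
    -- the chain of inequalities
    (∀ m : ℝ, 1 < m → m ≤ 3 →
      KreinFeller.lowerCoarseDim ν ≤ KreinFeller.lowerReducedEntropy ν m ∧
      KreinFeller.lowerReducedEntropy ν m ≤ KreinFeller.lowerSpectralDim ν ∧
      KreinFeller.lowerSpectralDim ν ≤ KreinFeller.lowerEntropy ν ∧
      KreinFeller.lowerEntropy ν ≤ KreinFeller.upperEntropy ν ∧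
      KreinFeller.upperEntropy ν = KreinFeller.upperReducedEntropy ν m ∧
      KreinFeller.upperReducedEntropy ν m = KreinFeller.upperSpectralDim ν ∧
      KreinFeller.upperSpectralDim ν = KreinFeller.upperFixedPoint ν ∧
      KreinFeller.upperFixedPoint ν = KreinFeller.upperCoarseDim ν) ∧
    KreinFeller.upperFixedPoint ν ≤ ((1 / 2 : ℝ) : EReal) ∧
    -- necessary condition for the spectral dimension to exist
    (KreinFeller.lowerSpectralDim ν = KreinFeller.upperSpectralDim ν →
      KreinFeller.lowerEntropy ν = KreinFeller.upperEntropy ν ∧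
      KreinFeller.upperEntropy ν = KreinFeller.upperSpectralDim ν) ∧
    -- sufficient condition for the spectral dimension to exist
    (KreinFeller.IsRegular ν →
      KreinFeller.lowerSpectralDim ν = KreinFeller.upperSpectralDim ν ∧
      KreinFeller.upperSpectralDim ν = KreinFeller.upperEntropy ν) ∧
    -- MF-regularity forces equality everywhere in the chain, and regularity
    (KreinFeller.IsMFRegular ν →
      (∀ m : ℝ, 1 < m → m ≤ 3 →
        KreinFeller.lowerCoarseDim ν = KreinFeller.lowerReducedEntropy ν m ∧
        KreinFeller.lowerReducedEntropy ν m = KreinFeller.lowerSpectralDim ν ∧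
        KreinFeller.lowerSpectralDim ν = KreinFeller.lowerEntropy ν ∧
        KreinFeller.lowerEntropy ν = KreinFeller.upperEntropy ν) ∧
      KreinFeller.IsRegular ν) ∧
    -- the maximal case
    (∀ m : ℝ, 1 < m → ((1 / 2 : ℝ) : EReal) ≤ KreinFeller.lowerReducedEntropy ν m →
      KreinFeller.lowerSpectralDim ν = ((1 / 2 : ℝ) : EReal) ∧
      KreinFeller.upperSpectralDim ν = ((1 / 2 : ℝ) : EReal) ∧
      KreinFeller.upperEntropy ν = ((1 / 2 : ℝ) : EReal)) := by
  have hred : ∀ m : ℝ, 1 < m → ∀ᶠ x in Filter.atTop,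
      KreinFeller.reducedCount ν m x ≤ KreinFeller.eigenvalueCount ν x := fun m hm =>
    (Filter.eventually_gt_atTop 0).mono fun x hx =>
      KreinFeller.reducedCount_le_eigenvalueCount hm hx
  have hpart : ∀ᶠ x in Filter.atTop,
      KreinFeller.eigenvalueCount ν x ≤ KreinFeller.partitionCount ν x :=
    (Filter.eventually_gt_atTop 0).mono fun x hx =>
      KreinFeller.eigenvalueCount_le_partitionCount hx
  have hrs : ∀ m : ℝ, 1 < m →
      KreinFeller.lowerReducedEntropy ν m ≤ KreinFeller.lowerSpectralDim ν := fun m hm =>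
    KreinFeller.lowerExponent_mono (hred m hm)
  have hrs' : ∀ m : ℝ, 1 < m →
      KreinFeller.upperReducedEntropy ν m ≤ KreinFeller.upperSpectralDim ν := fun m hm =>
    KreinFeller.upperExponent_mono (hred m hm)
  have hsh : KreinFeller.lowerSpectralDim ν ≤ KreinFeller.lowerEntropy ν :=
    KreinFeller.lowerExponent_mono hpart
  have hsh' : KreinFeller.upperSpectralDim ν ≤ KreinFeller.upperEntropy ν :=
    KreinFeller.upperExponent_mono hpart
  have hlu : KreinFeller.lowerEntropy ν ≤ KreinFeller.upperEntropy ν :=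
    KreinFeller.lowerExponent_le_upperExponent _
  have hss : KreinFeller.lowerSpectralDim ν ≤ KreinFeller.upperSpectralDim ν :=
    KreinFeller.lowerExponent_le_upperExponent _
  have hhq : KreinFeller.upperEntropy ν ≤ KreinFeller.upperFixedPoint ν :=
    KreinFeller.upperEntropy_le_upperFixedPoint hν hν0
  have hqF : KreinFeller.upperFixedPoint ν = KreinFeller.upperCoarseDim ν :=
    le_antisymm (KreinFeller.upperFixedPoint_le_upperCoarseDim hν hν0)
      (KreinFeller.upperCoarseDim_le_upperFixedPoint hν hν0)
  have hFr : ∀ m : ℝ, 1 < m → m ≤ 3 →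
      KreinFeller.upperCoarseDim ν ≤ KreinFeller.upperReducedEntropy ν m := fun m hm hm3 =>
    KreinFeller.upperCoarseDim_le_upperReducedEntropy hν hν0 hm hm3
  have hFr' : ∀ m : ℝ, 1 < m → m ≤ 3 →
      KreinFeller.lowerCoarseDim ν ≤ KreinFeller.lowerReducedEntropy ν m := fun m hm hm3 =>
    KreinFeller.lowerCoarseDim_le_lowerReducedEntropy hν hν0 hm hm3
  -- Any `m` in `(1, 3]` would do; 2 is arbitrary. This inequality closes the cycle.
  have hFs : KreinFeller.upperCoarseDim ν ≤ KreinFeller.upperSpectralDim ν :=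
    (hFr 2 (by norm_num) (by norm_num)).trans (hrs' 2 (by norm_num))
  have hhs : KreinFeller.upperEntropy ν = KreinFeller.upperSpectralDim ν :=
    le_antisymm (hhq.trans (hqF.le.trans hFs)) hsh'
  have hsq : KreinFeller.upperSpectralDim ν = KreinFeller.upperFixedPoint ν :=
    le_antisymm (hsh'.trans hhq) (hqF.le.trans hFs)
  have hhr : ∀ m : ℝ, 1 < m → m ≤ 3 →
      KreinFeller.upperEntropy ν = KreinFeller.upperReducedEntropy ν m := fun m hm hm3 =>
    le_antisymm (hhq.trans (hqF.le.trans (hFr m hm hm3))) ((hrs' m hm).trans hsh')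
  have hhalf := KreinFeller.upperFixedPoint_le_half hν hν0
  have hsup : (⨆ (m : ℝ) (_ : 1 < m), KreinFeller.lowerReducedEntropy ν m) ≤
      KreinFeller.lowerSpectralDim ν := iSup₂_le hrs
  refine ⟨fun n hn h => KreinFeller.existsUnique_lqBeta_eq hν hν0 hn h, fun m hm hm3 =>
    ⟨hFr' m hm hm3, hrs m hm, hsh, hlu, hhr m hm hm3, (hhr m hm hm3).symm.trans hhs, hsq, hqF⟩,
    hhalf, fun h => ⟨le_antisymm hlu ?_, hhs⟩, fun h => ⟨le_antisymm hss ?_, hhs.symm⟩,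
    fun h => ?_, fun m hm h => ?_⟩
  · rw [hhs, ← h]; exact hsh
  · rw [← hhs, ← h]; exact hsup
  -- Under MF-regularity the largest and the smallest members of the chain agree, which squeezes
  -- everything between them.
  · have hFh : KreinFeller.upperEntropy ν = KreinFeller.lowerCoarseDim ν := by
      rw [show KreinFeller.lowerCoarseDim ν = KreinFeller.upperCoarseDim ν from h, ← hqF, ← hsq,
        hhs]
    refine ⟨fun m hm hm3 => ?_, le_antisymm (hsup.trans (hsh.trans hlu)) ?_⟩
    · have h1 := hFr' m hm hm3
      have h2 := hrs m hm
      have h3 : KreinFeller.upperEntropy ν ≤ KreinFeller.lowerReducedEntropy ν m := hFh.le.trans h1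
      exact ⟨le_antisymm h1 ((h2.trans (hsh.trans hlu)).trans hFh.le),
        le_antisymm h2 ((hsh.trans hlu).trans h3), le_antisymm hsh (hlu.trans (h3.trans h2)),
        le_antisymm hlu (h3.trans (h2.trans hsh))⟩
    · exact (hFh.le.trans (hFr' 2 (by norm_num) (by norm_num))).trans
        (le_iSup₂ (f := fun (m : ℝ) (_ : 1 < m) => KreinFeller.lowerReducedEntropy ν m) 2
          (by norm_num))
  · have h1 := h.trans (hrs m hm)
    have h2 : KreinFeller.upperSpectralDim ν ≤ ((1 / 2 : ℝ) : EReal) := hsq.le.trans hhalf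
    have h3 := h1.trans hss
    exact ⟨le_antisymm (hss.trans h2) h1, le_antisymm h2 h3, hhs.trans (le_antisymm h2 h3)⟩
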